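/- Let $p\ge 1$, $n_0\ge 1$ and $\ell\ge 0$ be integers, and put $n_\ell=n_02^\ell$ and $h_\ell=1/n_\ell$. Let $\widetilde S_{p,\ell}(0,1)$ be the space of all functions in $C^{p-1}(0,1)$ that are polynomials of degree at most $p$ on each interval $((i-1)h_\ell,ih_\ell)$, $i=1,\dots,n_\ell$, and whose odd derivatives of order less than $p$ vanish at $0$ and at $1$. Let $\widehat S_{p,\ell}(-1,1)$ be the space of all functions in $C^{p-1}(-1,1)$ that are polynomials of degree at most $p$ on each of the $2n_\ell$ consecutive intervals of length $h_\ell$ in $(-1,1)$, and whose derivatives of each order $l$ with $0\le l<p$ agree at $-1$ and at $1$. (Boundary values are one-sided limits.) For $\Omega=(a,b)$ equip the Sobolev space $H^1(\Omega)$ with the scalar product $$(u,v)_{H^1_\circ(\Omega)}=\int_\Omega u'v'\,dx+\frac1{|\Omega|}\Big(\int_\Omega u\,dx\Big)\Big(\int_\Omega v\,dx\Big).$$ Then the $H^1_\circ(0,1)$-orthogonal projector $\widetilde\Pi_\ell:H^1(0,1)\to\widetilde S_{p,\ell}(0,1)$ and the $H^1_\circ(-1,1)$-orthogonal projector $\widehat\Pi_\ell:H^1(-1,1)\to\widehat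 S_{p,\ell}(-1,1)$ exist and are unique, and for every $u\in H^1(0,1)$: 1. $\|(I-\widetilde\Pi_\ell)u\|_{L^2(0,1)}\le\sqrt2\,h_\ell\,|u|_{H^1(0,1)}$, where $|u|_{H^1(0,1)}=\|u'\|_{L^2(0,1)}$; 2. the function $w(x)=u(|x|)$ lies in $H^1(-1,1)$, and the restriction of $\widehat\Pi_\ell w$ to $(0,1)$ equals $\widetilde\Pi_\ell u$. -/

import Mathlib

open MeasureTheory Set Filter Topology
open scoped ContDiff Polynomial

namespace SplineApprox

/-- The real Lebesgue space `L²(a, b)`. -/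
abbrev L2 (a b : ℝ) : Type := Lp ℝ 2 (volume.restrict (Ioo a b))

/-- `g` is a weak derivative of `u` on the open interval `(a, b)`: integration by parts holds
against every smooth function with compact support in `(a, b)`. -/
def HasWeakDeriv (a b : ℝ) (u g : ℝ → ℝ) : Prop :=
  ∀ φ : ℝ → ℝ, ContDiff ℝ ∞ φ → HasCompactSupport φ → tsupport φ ⊆ Ioo a b →
    ∫ x in Ioo a b, u x * deriv φ x = - ∫ x in Ioo a b, g x * φ x

lemma integrable_mul_test {a b : ℝ} (u : L2 a b) {ψ : ℝ → ℝ} (hψ : Continuous ψ)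
    (hc : HasCompactSupport ψ) : Integrable (fun x => u x * ψ x) (volume.restrict (Ioo a b)) :=
  have h2 : MemLp ψ 2 (volume.restrict (Ioo a b)) :=
    (hψ.memLp_of_hasCompactSupport hc).restrict _
  (Lp.memLp u).integrable_mul h2

/-- The Sobolev space `H¹(a, b)`: the classes in `L²(a, b)` with a weak derivative in
`L²(a, b)`. -/
def H1 (a b : ℝ) : Submodule ℝ (L2 a b) where
  carrier := {u | ∃ g : L2 a b, HasWeakDeriv a b u g}
  zero_mem' := by
    refine ⟨0, fun φ _ _ _ => ?_⟩
    have h : ((0 : L2 a b) : ℝ → ℝ) =ᵐ[volume.restrict (Ioo a b)] 0 := Lp.coeFn_zero _ _ _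
    rw [integral_eq_zero_of_ae, integral_eq_zero_of_ae, neg_zero]
    · filter_upwards [h] with x hx
      simp only [hx, Pi.zero_apply, zero_mul]
    · filter_upwards [h] with x hx
      simp only [hx, Pi.zero_apply, zero_mul]
  add_mem' := by
    rintro u v ⟨g, hg⟩ ⟨k, hk⟩
    refine ⟨g + k, fun φ h1 h2 h3 => ?_⟩
    have hd : Continuous (deriv φ) := h1.continuous_deriv (by simp)
    have e1 : ∫ x in Ioo a b, (u + v : L2 a b) x * deriv φ x
        = ∫ x in Ioo a b, (u x * deriv φ x + v x * deriv φ x) := by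
      refine integral_congr_ae ?_
      filter_upwards [Lp.coeFn_add u v] with x hx
      rw [hx, Pi.add_apply, add_mul]
    have e2 : ∫ x in Ioo a b, (g + k : L2 a b) x * φ x
        = ∫ x in Ioo a b, (g x * φ x + k x * φ x) := by
      refine integral_congr_ae ?_
      filter_upwards [Lp.coeFn_add g k] with x hx
      rw [hx, Pi.add_apply, add_mul]
    rw [e1, e2, integral_add (integrable_mul_test u hd h2.deriv) (integrable_mul_test v hd h2.deriv),
      integral_add (integrable_mul_test g h1.continuous h2)
        (integrable_mul_test k h1.continuous h2), hg φ h1 h2 h3, hk φ h1 h2 h3]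
    ring
  smul_mem' := by
    rintro c u ⟨g, hg⟩
    refine ⟨c • g, fun φ h1 h2 h3 => ?_⟩
    have e1 : ∫ x in Ioo a b, (c • u : L2 a b) x * deriv φ x
        = ∫ x in Ioo a b, c * (u x * deriv φ x) := by
      refine integral_congr_ae ?_
      filter_upwards [Lp.coeFn_smul c u] with x hx
      rw [hx, Pi.smul_apply, smul_eq_mul, mul_assoc]
    have e2 : ∫ x in Ioo a b, (c • g : L2 a b) x * φ x
        = ∫ x in Ioo a b, c * (g x * φ x) := by
      refine integral_congr_ae ?_
      filter_upwards [Lp.coeFn_smul c g] with x hx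
      rw [hx, Pi.smul_apply, smul_eq_mul, mul_assoc]
    rw [e1, e2, integral_const_mul, integral_const_mul, hg φ h1 h2 h3]
    ring

/-- The weak derivative of an `H¹` function, as an element of `L²(a, b)`. -/
noncomputable def weakDeriv {a b : ℝ} (u : H1 a b) : L2 a b := u.2.choose

lemma weakDeriv_spec {a b : ℝ} (u : H1 a b) :
    HasWeakDeriv a b (u : L2 a b) (weakDeriv u) := u.2.choose_spec

/-- The weak derivative is unique, so that `weakDeriv` does not depend on a choice. -/
lemma weakDeriv_unique {a b : ℝ} (u : H1 a b) (g : L2 a b)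
    (hg : HasWeakDeriv a b (u : L2 a b) g) : g = weakDeriv u := by
  have hint : IntegrableOn (g - weakDeriv u : L2 a b) (Ioo a b) :=
    (Lp.memLp (g - weakDeriv u)).integrable (by norm_num)
  have key : ∀ᵐ x, x ∈ Ioo a b → (g - weakDeriv u : L2 a b) x = 0 := by
    refine isOpen_Ioo.ae_eq_zero_of_integral_contDiff_smul_eq_zero
      hint.locallyIntegrableOn fun φ h1 h2 h3 => ?_
    have e0 : ∫ x, φ x • (g - weakDeriv u : L2 a b) x
        = ∫ x in Ioo a b, φ x • (g - weakDeriv u : L2 a b) x := by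
      refine (setIntegral_eq_integral_of_forall_compl_eq_zero fun x hx => ?_).symm
      rw [image_eq_zero_of_notMem_tsupport fun h => hx (h3 h), zero_smul]
    have e1 : ∫ x in Ioo a b, φ x • (g - weakDeriv u : L2 a b) x
        = ∫ x in Ioo a b, (g x * φ x - weakDeriv u x * φ x) := by
      refine integral_congr_ae ?_
      filter_upwards [Lp.coeFn_sub g (weakDeriv u)] with x hx
      rw [hx, Pi.sub_apply, smul_eq_mul]
      ring
    have e2 := hg φ h1 h2 h3
    have e3 := weakDeriv_spec u φ h1 h2 h3
    rw [e0, e1, integral_sub (integrable_mul_test g h1.continuous h2)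
      (integrable_mul_test _ h1.continuous h2)]
    linarith
  rw [← sub_eq_zero, Lp.eq_zero_iff_ae_eq_zero]
  exact (ae_restrict_iff' measurableSet_Ioo).2 key

/-- The scalar product `(u, v) = (u', v')_{L²} + |(a, b)|⁻¹ (∫ u) (∫ v)` on `H¹(a, b)`. -/
noncomputable def circInner {a b : ℝ} (u v : H1 a b) : ℝ :=
  (∫ x in Ioo a b, weakDeriv u x * weakDeriv v x)
    + 1 / (b - a) * (∫ x in Ioo a b, (u : L2 a b) x) * ∫ x in Ioo a b, (v : L2 a b) x

/-- `P` is the orthogonal projector of `H¹(a, b)` onto `S` with respect to `circInner`. -/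
structure IsCircProjector {a b : ℝ} (S : Submodule ℝ (H1 a b))
    (P : H1 a b →ₗ[ℝ] H1 a b) : Prop where
  mem : ∀ u, P u ∈ S
  orth : ∀ u, ∀ v ∈ S, circInner (u - P u) v = 0

/-- Splines of degree `p` with maximum smoothness on the uniform grid with `N` cells on `(a, b)`:
functions in `C^{p-1}(a, b)` that are polynomials of degree at most `p` on every open cell. -/
structure IsSpline (p N : ℕ) (a b : ℝ) (f : ℝ → ℝ) : Prop where
  contDiffOn : ContDiffOn ℝ ((p - 1 : ℕ) : ℕ∞) f (Ioo a b)
  piecewise : ∀ i < N, ∃ q : ℝ[X], q.natDegree ≤ p ∧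
    ∀ x ∈ Ioo (a + i * ((b - a) / N)) (a + (i + 1) * ((b - a) / N)), f x = q.eval x

/-- The odd derivatives of `f` of order less than `p` vanish at both ends of `(a, b)`
(the boundary values of derivatives are one-sided limits). -/
def OddDerivsVanish (p : ℕ) (a b : ℝ) (f : ℝ → ℝ) : Prop :=
  ∀ l : ℕ, 2 * l + 1 < p →
    Tendsto (iteratedDeriv (2 * l + 1) f) (𝓝[>] a) (𝓝 0) ∧
    Tendsto (iteratedDeriv (2 * l + 1) f) (𝓝[<] b) (𝓝 0)

/-- The derivatives of `f` of order less than `p` (including `f`) agree at both ends of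
`(a, b)`. -/
def PeriodicDerivs (p : ℕ) (a b : ℝ) (f : ℝ → ℝ) : Prop :=
  ∀ l : ℕ, l < p → ∃ c : ℝ,
    Tendsto (iteratedDeriv l f) (𝓝[>] a) (𝓝 c) ∧ Tendsto (iteratedDeriv l f) (𝓝[<] b) (𝓝 c)

lemma IsSpline.zero (p N : ℕ) (a b : ℝ) : IsSpline p N a b 0 :=
  ⟨contDiffOn_const, fun _ _ => ⟨0, by simp, by simp⟩⟩

lemma IsSpline.add {p N : ℕ} {a b : ℝ} {f g : ℝ → ℝ} (hf : IsSpline p N a b f)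
    (hg : IsSpline p N a b g) : IsSpline p N a b (f + g) := by
  refine ⟨hf.1.add hg.1, fun i hi => ?_⟩
  obtain ⟨q, hq, hq'⟩ := hf.2 i hi
  obtain ⟨r, hr, hr'⟩ := hg.2 i hi
  exact ⟨q + r, Polynomial.natDegree_add_le_of_degree_le hq hr,
    fun x hx => by simp [hq' x hx, hr' x hx]⟩

lemma IsSpline.smul {p N : ℕ} {a b : ℝ} {f : ℝ → ℝ} (c : ℝ) (hf : IsSpline p N a b f) :
    IsSpline p N a b (c • f) := by
  refine ⟨hf.1.const_smul c, fun i hi => ?_⟩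
  obtain ⟨q, hq, hq'⟩ := hf.2 i hi
  exact ⟨c • q, (Polynomial.natDegree_smul_le c q).trans hq,
    fun x hx => by simp [hq' x hx]⟩

lemma IsSpline.contDiffAt {p N : ℕ} {a b : ℝ} {f : ℝ → ℝ} (hf : IsSpline p N a b f)
    {k : ℕ} (hk : k < p) {x : ℝ} (hx : x ∈ Ioo a b) : ContDiffAt ℝ k f x := by
  refine (hf.1.contDiffAt (isOpen_Ioo.mem_nhds hx)).of_le ?_
  exact_mod_cast Nat.le_sub_one_of_lt hk

lemma tendsto_add {p N k : ℕ} {a b c d : ℝ} {F : Filter ℝ} {f g : ℝ → ℝ}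
    (hf : IsSpline p N a b f) (hg : IsSpline p N a b g) (hk : k < p) (hF : Ioo a b ∈ F)
    (h1 : Tendsto (iteratedDeriv k f) F (𝓝 c)) (h2 : Tendsto (iteratedDeriv k g) F (𝓝 d)) :
    Tendsto (iteratedDeriv k (f + g)) F (𝓝 (c + d)) := by
  refine (h1.add h2).congr' ?_
  filter_upwards [hF] with x hx
  rw [iteratedDeriv_add (hf.contDiffAt hk hx) (hg.contDiffAt hk hx)]

lemma tendsto_smul {k : ℕ} {c d : ℝ} {F : Filter ℝ} {f : ℝ → ℝ}
    (h1 : Tendsto (iteratedDeriv k f) F (𝓝 d)) :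
    Tendsto (iteratedDeriv k (c • f)) F (𝓝 (c * d)) := by
  refine (h1.const_mul c).congr fun x => ?_
  rw [iteratedDeriv_const_smul_field, smul_eq_mul]

/-- The space of all splines of degree `p` on `(0, 1)` with `n` cells whose odd derivatives of
order less than `p` vanish at the boundary, as a subspace of `H¹(0, 1)` (for `p ≥ 1` a spline is
continuous and piecewise polynomial, hence its class lies in `H¹`). -/
def splineTilde (p n : ℕ) : Submodule ℝ (H1 0 1) where
  carrier := {u | ∃ f : ℝ → ℝ, IsSpline p n 0 1 f ∧ OddDerivsVanish p 0 1 f ∧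
    ((u : L2 0 1) : ℝ → ℝ) =ᵐ[volume.restrict (Ioo 0 1)] f}
  zero_mem' := by
    refine ⟨0, IsSpline.zero p n 0 1, fun l _ => ?_, Lp.coeFn_zero _ _ _⟩
    have h : iteratedDeriv (2 * l + 1) (0 : ℝ → ℝ) = fun _ => 0 := by
      ext x
      exact (iteratedDeriv_const (n := 2 * l + 1) (c := (0 : ℝ)) (x := x)).trans (by simp)
    rw [h]
    exact ⟨tendsto_const_nhds, tendsto_const_nhds⟩
  add_mem' := by
    rintro u v ⟨f, hf, hf', hu⟩ ⟨g, hg, hg', hv⟩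
    refine ⟨f + g, hf.add hg, fun l hl => ⟨?_, ?_⟩,
      (Lp.coeFn_add (u : L2 0 1) (v : L2 0 1)).trans (hu.add hv)⟩
    · simpa using tendsto_add hf hg hl (Ioo_mem_nhdsGT one_pos) (hf' l hl).1 (hg' l hl).1
    · simpa using tendsto_add hf hg hl (Ioo_mem_nhdsLT one_pos) (hf' l hl).2 (hg' l hl).2
  smul_mem' := by
    rintro c u ⟨f, hf, hf', hu⟩
    refine ⟨c • f, hf.smul c, fun l hl => ⟨?_, ?_⟩,
      (Lp.coeFn_smul c (u : L2 0 1)).trans (hu.const_smul c)⟩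
    · simpa using tendsto_smul (c := c) (hf' l hl).1
    · simpa using tendsto_smul (c := c) (hf' l hl).2

/-- The space of all periodic splines of degree `p` on `(-1, 1)` with grid size `1 / n` (that is,
with `2 n` cells), as a subspace of `H¹(-1, 1)`. -/
def splinePeriodic (p n : ℕ) : Submodule ℝ (H1 (-1) 1) where
  carrier := {u | ∃ f : ℝ → ℝ, IsSpline p (2 * n) (-1) 1 f ∧ PeriodicDerivs p (-1) 1 f ∧
    ((u : L2 (-1) 1) : ℝ → ℝ) =ᵐ[volume.restrict (Ioo (-1) 1)] f}
  zero_mem' := by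
    refine ⟨0, IsSpline.zero p (2 * n) (-1) 1, fun l _ => ⟨0, ?_⟩, Lp.coeFn_zero _ _ _⟩
    have h : iteratedDeriv l (0 : ℝ → ℝ) = fun _ => 0 := by
      ext x
      exact (iteratedDeriv_const (n := l) (c := (0 : ℝ)) (x := x)).trans (by simp)
    rw [h]
    exact ⟨tendsto_const_nhds, tendsto_const_nhds⟩
  add_mem' := by
    rintro u v ⟨f, hf, hf', hu⟩ ⟨g, hg, hg', hv⟩
    refine ⟨f + g, hf.add hg, fun l hl => ?_,
      (Lp.coeFn_add (u : L2 (-1) 1) (v : L2 (-1) 1)).trans (hu.add hv)⟩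
    obtain ⟨c, hc1, hc2⟩ := hf' l hl
    obtain ⟨d, hd1, hd2⟩ := hg' l hl
    exact ⟨c + d, tendsto_add hf hg hl (Ioo_mem_nhdsGT (by norm_num)) hc1 hd1,
      tendsto_add hf hg hl (Ioo_mem_nhdsLT (by norm_num)) hc2 hd2⟩
  smul_mem' := by
    rintro c u ⟨f, hf, hf', hu⟩
    refine ⟨c • f, hf.smul c, fun l hl => ?_,
      (Lp.coeFn_smul c (u : L2 (-1) 1)).trans (hu.const_smul c)⟩
    obtain ⟨d, hd1, hd2⟩ := hf' l hl
    exact ⟨c * d, tendsto_smul hd1, tendsto_smul hd2⟩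

/-- The number `n_ℓ = n₀ 2^ℓ` of cells on `(0, 1)` at level `ℓ`. -/
def cells (n₀ ℓ : ℕ) : ℕ := n₀ * 2 ^ ℓ

/-- The grid size `h_ℓ = 1 / n_ℓ`. -/
noncomputable def gridSize (n₀ ℓ : ℕ) : ℝ := 1 / (cells n₀ ℓ : ℝ)

end SplineApprox

/-! The scalar product is definite, because a function with zero derivative is constant and its mean
detects the constant. The spline spaces are finite-dimensional, so both projectors exist and are
unique.

Error estimate. Write `K` for the mean-zero primitive (`prim true`) and `L` for the primitive of `f`
minus its mean (`prim false`). Integration by parts gives `K* = -L`. Starting from indicators of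
cells and applying `K` and `L` alternately yields `splineFamily`. Its members of type `false` and
degree `p - 1` are derivatives of functions in `splineTilde p n`. The key estimate is
`integral_prim_sq_le`: a function orthogonal to the family of one type has a primitive of the other
type of norm at most `h` times its own. For degree 0 the function has mean zero on every cell, so
its primitive vanishes at the nodes. A degree is gained by duality: if `s = Kf`, then `‖s‖² = -(f,
Ls)`, and the orthogonality of `f` passes to `s` one degree lower, so `‖Ls‖ ≤ h‖s‖` and hence `‖s‖ ≤
h‖f‖`. The error `e` of the projector has mean zero, so `e = Ke'`, and `e'` is orthogonal to the
family. This gives the bound with constant 1 (`norm_sub_projector_le`), which is stronger than √2.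

Symmetry. Even extension maps `splineTilde` into the periodic splines, and folding `v ↦ v(x) +
v(-x)` maps back. The two operations are adjoint for the scalar products (`IsEvenExt.circInner_eq`),
so the even extension of the projection satisfies the orthogonality relations of the periodic
projection (`isEvenExt_projector`). -/

namespace SplineApprox

/-! ### Weak derivatives and primitives on an interval. -/

lemma setIntegral_Ioo {a b : ℝ} (hab : a ≤ b) (f : ℝ → ℝ) :
    ∫ x in Ioo a b, f x = ∫ x in a..b, f x := by
  rw [intervalIntegral.integral_of_le hab, integral_Ioc_eq_integral_Ioo]

lemma ae_uIoc_of_ae_Ioo {a b : ℝ} (hab : a ≤ b) {p : ℝ → Prop}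
    (h : ∀ᵐ x ∂volume.restrict (Ioo a b), p x) : ∀ᵐ x, x ∈ uIoc a b → p x := by
  rw [uIoc_of_le hab]
  rw [restrict_Ioo_eq_restrict_Ioc] at h
  exact (ae_restrict_iff' measurableSet_Ioc).1 h

/-- Integration by parts for primitives of integrable functions. -/
lemma integral_mul_primitive {a b : ℝ} {f g : ℝ → ℝ} (hf : IntervalIntegrable f volume a b)
    (hg : IntervalIntegrable g volume a b) :
    ∫ x in a..b, f x * ∫ t in a..x, g t =
      (∫ x in a..b, f x) * (∫ x in a..b, g x) - ∫ x in a..b, (∫ t in a..x, f t) * g x := by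
  have hF := hf.absolutelyContinuousOnInterval_intervalIntegral (c := a) left_mem_uIcc
  have hG := hg.absolutelyContinuousOnInterval_intervalIntegral (c := a) left_mem_uIcc
  have key := hF.integral_mul_deriv_eq_deriv_mul hG
  have e1 : ∫ x in a..b, (∫ t in a..x, f t) * deriv (fun x => ∫ t in a..x, g t) x
      = ∫ x in a..b, (∫ t in a..x, f t) * g x := by
    refine intervalIntegral.integral_congr_ae ?_
    filter_upwards [hg.ae_hasDerivAt_integral] with x hx h
    rw [(hx (uIoc_subset_uIcc h) a left_mem_uIcc).deriv]
  have e2 : ∫ x in a..b, deriv (fun x => ∫ t in a..x, f t) x * (∫ t in a..x, g t)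
      = ∫ x in a..b, f x * ∫ t in a..x, g t := by
    refine intervalIntegral.integral_congr_ae ?_
    filter_upwards [hf.ae_hasDerivAt_integral] with x hx h
    rw [(hx (uIoc_subset_uIcc h) a left_mem_uIcc).deriv]
  rw [e1, e2] at key
  simp only [intervalIntegral.integral_same, zero_mul, sub_zero] at key
  linarith

lemma intervalIntegrable_of_Ioo {a b : ℝ} (hab : a ≤ b) {g : ℝ → ℝ}
    (hg : IntegrableOn g (Ioo a b)) : IntervalIntegrable g volume a b :=
  (intervalIntegrable_iff_integrableOn_Ioo_of_le hab).2 hg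

lemma L2.integrableOn {a b : ℝ} (g : L2 a b) : IntegrableOn g (Ioo a b) :=
  (Lp.memLp g).integrable (by norm_num)

lemma continuousOn_primitive_Icc {a b : ℝ} (hab : a ≤ b) {g : ℝ → ℝ}
    (hg : IntegrableOn g (Ioo a b)) : ContinuousOn (fun x => ∫ t in a..x, g t) (Icc a b) := by
  have := intervalIntegral.continuousOn_primitive_interval'
    (intervalIntegrable_of_Ioo hab hg) left_mem_uIcc
  rwa [uIcc_of_le hab] at this

lemma test_eq_zero {a b x : ℝ} {φ : ℝ → ℝ} (h : tsupport φ ⊆ Ioo a b) (hx : x ∉ Ioo a b) :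
    φ x = 0 := image_eq_zero_of_notMem_tsupport fun h' => hx (h h')

/-- A function that differs from a primitive of `g` by a constant has the weak derivative `g`. -/
lemma hasWeakDeriv_of_ae_eq {a b : ℝ} (hab : a ≤ b) {u g : ℝ → ℝ} {c : ℝ}
    (hg : IntegrableOn g (Ioo a b))
    (hu : ∀ᵐ x ∂volume.restrict (Ioo a b), u x = c + ∫ t in a..x, g t) :
    HasWeakDeriv a b u g := by
  intro φ h1 h2 h3
  have hd : Continuous (deriv φ) := h1.continuous_deriv (by simp)
  have hdi : ∀ x y, IntervalIntegrable (deriv φ) volume x y := fun x y => hd.intervalIntegrable x y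
  have hFTC : ∀ x, ∫ t in a..x, deriv φ t = φ x := fun x => by
    rw [intervalIntegral.integral_deriv_eq_sub (fun y _ => (h1.differentiable (by simp)) y)
      (hdi a x), test_eq_zero h3 (x := a) (by simp), sub_zero]
  have hgi := intervalIntegrable_of_Ioo hab hg
  have hb : φ b = 0 := test_eq_zero h3 (by simp)
  have e1 : ∫ x in Ioo a b, u x * deriv φ x
      = ∫ x in a..b, (c * deriv φ x + deriv φ x * ∫ t in a..x, g t) := by
    rw [← setIntegral_Ioo hab]
    refine integral_congr_ae ?_
    filter_upwards [hu] with x hx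
    rw [hx]; ring
  have hi : IntervalIntegrable (fun x => deriv φ x * ∫ t in a..x, g t) volume a b := by
    refine ContinuousOn.intervalIntegrable ?_
    rw [uIcc_of_le hab]
    exact hd.continuousOn.mul (continuousOn_primitive_Icc hab hg)
  -- Since `φ` vanishes at both ends, integration by parts leaves no boundary term and the constant
  -- `c` drops out.
  rw [e1, intervalIntegral.integral_add ((hdi a b).const_mul c) hi,
    intervalIntegral.integral_const_mul, integral_mul_primitive (hdi a b) hgi, hFTC, hb,
    setIntegral_Ioo hab]
  simp only [hFTC, mul_zero, zero_mul, zero_sub, zero_add]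
  simp only [mul_comm]

/-- The lemma of du Bois-Reymond. -/
lemma ae_eq_const_of_integral_mul_deriv_eq_zero {a b : ℝ} (hab : a < b) {v : ℝ → ℝ}
    (hv : IntegrableOn v (Ioo a b))
    (h : ∀ φ : ℝ → ℝ, ContDiff ℝ ∞ φ → HasCompactSupport φ → tsupport φ ⊆ Ioo a b →
      ∫ x in Ioo a b, v x * deriv φ x = 0) :
    ∃ c : ℝ, ∀ᵐ x ∂volume.restrict (Ioo a b), v x = c := by
  -- A bump of mass one whose closed support, of radius `(b - a) / 4` around the midpoint, lies
  -- inside `(a, b)`.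
  let B : ContDiffBump ((a + b) / 2 : ℝ) := ⟨(b - a) / 8, (b - a) / 4, by linarith, by linarith⟩
  let θ : ℝ → ℝ := B.normed volume
  have θ1 : ContDiff ℝ ∞ θ := B.contDiff_normed
  have θ2 : HasCompactSupport θ := B.hasCompactSupport_normed
  have θ3 : tsupport θ ⊆ Ioo a b := by
    rw [show tsupport θ = _ from B.tsupport_normed_eq, Real.closedBall_eq_Icc]
    intro x hx
    simp only [B, mem_Icc] at hx
    constructor <;> linarith [hx.1, hx.2]
  have θ4 : ∫ x, θ x = 1 := B.integral_normed
  refine ⟨∫ x in Ioo a b, v x * θ x, ?_⟩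
  set c := ∫ x in Ioo a b, v x * θ x with hc
  have hvi : ∀ ψ : ℝ → ℝ, Continuous ψ → Integrable (fun x => v x * ψ x)
      (volume.restrict (Ioo a b)) := fun ψ hψ => by
    have := (intervalIntegrable_of_Ioo hab.le hv).mul_continuousOn (hψ.continuousOn)
    exact (intervalIntegrable_iff_integrableOn_Ioo_of_le hab.le).1 this
  have hres : ∀ ψ : ℝ → ℝ, tsupport ψ ⊆ Ioo a b → ∫ x, ψ x = ∫ x in Ioo a b, ψ x := fun ψ hψ =>
    (setIntegral_eq_integral_of_forall_compl_eq_zero fun x hx => test_eq_zero hψ hx).symm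
  have key : ∀ᵐ x, x ∈ Ioo a b → v x - c = 0 := by
    refine isOpen_Ioo.ae_eq_zero_of_integral_contDiff_smul_eq_zero
      (hv.sub (integrable_const c)).locallyIntegrableOn fun ψ h1 h2 h3 => ?_
    set m := ∫ x, ψ x with hm
    -- Removing the mass of `ψ` makes the primitive of `η` compactly supported, so `η` is the
    -- derivative of an admissible test function.
    let η : ℝ → ℝ := fun x => ψ x - m * θ x
    have η1 : ContDiff ℝ ∞ η := h1.sub (contDiff_const.mul θ1)
    have ηc : Continuous η := η1.continuous
    have ηi : ∫ x in a..b, η x = 0 := by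
      simp only [η]
      rw [intervalIntegral.integral_sub (h1.continuous.intervalIntegrable _ _)
        ((θ1.continuous.intervalIntegrable _ _).const_mul m),
        intervalIntegral.integral_const_mul, ← setIntegral_Ioo hab.le, ← setIntegral_Ioo hab.le,
        ← hres ψ h3, ← hres θ θ3, θ4, ← hm]
      ring
    let φ : ℝ → ℝ := fun x => ∫ t in a..x, η t
    have φd : ∀ x, HasDerivAt φ (η x) x := fun x =>
      intervalIntegral.integral_hasDerivAt_right (ηc.intervalIntegrable _ _)
        (ηc.stronglyMeasurableAtFilter _ _) ηc.continuousAt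
    have φd' : deriv φ = η := funext fun x => (φd x).deriv
    have φ1 : ContDiff ℝ ∞ φ := by
      rw [contDiff_infty_iff_deriv]
      exact ⟨fun x => (φd x).differentiableAt, φd' ▸ η1⟩
    let K : Set ℝ := tsupport ψ ∪ tsupport θ
    have Kc : IsCompact K := h2.isCompact.union θ2.isCompact
    have Ks : K ⊆ Ioo a b := union_subset h3 θ3
    have ηK : ∀ x, x ∉ K → η x = 0 := fun x hx => by
      simp only [η, image_eq_zero_of_notMem_tsupport fun h' => hx (Or.inl h'),
        image_eq_zero_of_notMem_tsupport fun h' => hx (Or.inr h'), mul_zero, sub_zero]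
    have Kne : K.Nonempty := by
      by_contra hne
      rw [not_nonempty_iff_eq_empty] at hne
      have : ∫ x, θ x = 0 := by
        have : θ = 0 := funext fun x => image_eq_zero_of_notMem_tsupport fun h' => by
          have : x ∈ K := Or.inr h'
          simp [hne] at this
        simp [this]
      linarith
    obtain ⟨l, hl, hl'⟩ := Kc.exists_isLeast Kne
    obtain ⟨r, hr, hr'⟩ := Kc.exists_isGreatest Kne
    -- To the left of the support nothing has been integrated yet; to the right the whole integral
    -- of `η`, which is zero, has been.
    have φs : ∀ x, x ∉ Icc l r → φ x = 0 := by
      intro x hx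
      rw [mem_Icc, not_and_or, not_le, not_le] at hx
      rcases hx with hx | hx
      · refine intervalIntegral.integral_zero_ae (Eventually.of_forall fun t ht => ηK t fun hK => ?_)
        have h5 := hl' hK
        have h6 := (Ks hl).1
        rcases mem_uIoc.1 ht with h | h <;> linarith [h.1, h.2]
      · have : φ x = (∫ t in a..b, η t) + ∫ t in b..x, η t :=
          (intervalIntegral.integral_add_adjacent_intervals (ηc.intervalIntegrable _ _)
            (ηc.intervalIntegrable _ _)).symm
        rw [this, ηi, zero_add]
        refine intervalIntegral.integral_zero_ae (Eventually.of_forall fun t ht => ηK t fun hK => ?_)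
        have h5 := hr' hK
        have h6 := (Ks hr).2
        rcases mem_uIoc.1 ht with h | h <;> linarith [h.1, h.2]
    have φ2 : tsupport φ ⊆ Icc l r :=
      closure_minimal (fun x hx => by_contra fun h' => hx (φs x h')) isClosed_Icc
    have φ3 : HasCompactSupport φ := isCompact_Icc.of_isClosed_subset (isClosed_tsupport φ) φ2
    have h0 := h φ φ1 φ3 (φ2.trans (Icc_subset_Ioo (Ks hl).1 (Ks hr).2))
    rw [φd'] at h0
    have e0 : ∫ x, ψ x • (v x - c) = ∫ x in Ioo a b, ψ x • (v x - c) :=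
      (setIntegral_eq_integral_of_forall_compl_eq_zero fun x hx => by
        rw [test_eq_zero h3 hx, zero_smul]).symm
    have e1 : ∫ x in Ioo a b, ψ x • (v x - c)
        = (∫ x in Ioo a b, v x * ψ x) - c * m := by
      rw [hm, hres ψ h3, ← integral_const_mul, ← integral_sub (hvi ψ h1.continuous)]
      · refine integral_congr_ae (Eventually.of_forall fun x => ?_)
        simp only [smul_eq_mul]; ring
      · exact (h1.continuous.integrable_of_hasCompactSupport h2).integrableOn.const_mul c
    have e2 : ∫ x in Ioo a b, v x * η x = (∫ x in Ioo a b, v x * ψ x) - m * c := by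
      rw [hc, ← integral_const_mul, ← integral_sub (hvi ψ h1.continuous)
        ((hvi θ θ1.continuous).const_mul m)]
      refine integral_congr_ae (Eventually.of_forall fun x => ?_)
      simp only [η]; ring
    rw [e0, e1]
    linarith
  refine (ae_restrict_iff' measurableSet_Ioo).2 ?_
  filter_upwards [key] with x hx hx'
  linarith [hx hx']

/-- A function with an integrable weak derivative `g` differs from a primitive of `g` by a
constant. -/
lemma HasWeakDeriv.exists_ae_eq {a b : ℝ} (hab : a < b) {u g : ℝ → ℝ}
    (hu : IntegrableOn u (Ioo a b)) (hg : IntegrableOn g (Ioo a b)) (h : HasWeakDeriv a b u g) :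
    ∃ c : ℝ, ∀ᵐ x ∂volume.restrict (Ioo a b), u x = c + ∫ t in a..x, g t := by
  have hG : IntegrableOn (fun x => ∫ t in a..x, g t) (Ioo a b) :=
    ((continuousOn_primitive_Icc hab.le hg).integrableOn_Icc).mono_set Ioo_subset_Icc_self
  obtain ⟨c, hc⟩ := ae_eq_const_of_integral_mul_deriv_eq_zero hab (hu.sub hG) fun φ h1 h2 h3 => by
    have hd : Continuous (deriv φ) := h1.continuous_deriv (by simp)
    have e1 := h φ h1 h2 h3
    have e2 := hasWeakDeriv_of_ae_eq (u := fun x => 0 + ∫ t in a..x, g t) hab.le hg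
      (Eventually.of_forall fun x => rfl) φ h1 h2 h3
    have hint : ∀ v : ℝ → ℝ, IntegrableOn v (Ioo a b) →
        Integrable (fun x => v x * deriv φ x) (volume.restrict (Ioo a b)) := fun v hv =>
      (intervalIntegrable_iff_integrableOn_Ioo_of_le hab.le).1
        ((intervalIntegrable_of_Ioo hab.le hv).mul_continuousOn hd.continuousOn)
    simp only [zero_add] at e2
    simp only [Pi.sub_apply, sub_mul]
    rw [integral_sub (hint u hu) (hint _ hG), e1, e2, sub_self]
  refine ⟨c, ?_⟩
  filter_upwards [hc] with x hx
  simp only [Pi.sub_apply] at hx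
  linarith

lemma H1.exists_ae_eq {a b : ℝ} (hab : a < b) (u : H1 a b) :
    ∃ c : ℝ, ∀ᵐ x ∂volume.restrict (Ioo a b), (u : L2 a b) x = c + ∫ t in a..x, weakDeriv u t :=
  (weakDeriv_spec u).exists_ae_eq hab (L2.integrableOn _) (L2.integrableOn _)

/-- Primitives of square integrable functions are in `H¹`. -/
lemma exists_H1_of_primitive {a b : ℝ} (hab : a ≤ b) {g : ℝ → ℝ}
    (hg : MemLp g 2 (volume.restrict (Ioo a b))) (c : ℝ) :
    ∃ u : H1 a b, (∀ᵐ x ∂volume.restrict (Ioo a b), (u : L2 a b) x = c + ∫ t in a..x, g t) ∧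
      weakDeriv u =ᵐ[volume.restrict (Ioo a b)] g := by
  have hgi : IntegrableOn g (Ioo a b) := hg.integrable (by norm_num)
  have hcont : ContinuousOn (fun x => c + ∫ t in a..x, g t) (Icc a b) :=
    continuousOn_const.add (continuousOn_primitive_Icc hab hgi)
  have hU : MemLp (fun x => c + ∫ t in a..x, g t) 2 (volume.restrict (Ioo a b)) := by
    obtain ⟨C, hC⟩ := isCompact_Icc.exists_bound_of_continuousOn hcont
    refine MemLp.of_bound ((hcont.mono Ioo_subset_Icc_self).aestronglyMeasurable
      measurableSet_Ioo) C ?_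
    exact (ae_restrict_iff' measurableSet_Ioo).2
      (Eventually.of_forall fun x hx => hC x (Ioo_subset_Icc_self hx))
  have hcoe := hg.coeFn_toLp
  have hw : HasWeakDeriv a b (hU.toLp _) (hg.toLp _) := by
    refine hasWeakDeriv_of_ae_eq (c := c) hab (L2.integrableOn _) ?_
    filter_upwards [hU.coeFn_toLp, ae_restrict_mem measurableSet_Ioo] with x hx hx'
    rw [hx]
    congr 1
    -- Inside the integral `g` is replaced by the chosen representative of its class.
    refine intervalIntegral.integral_congr_ae ?_
    filter_upwards [ae_uIoc_of_ae_Ioo hab hcoe] with t ht ht'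
    refine (ht ?_).symm
    rw [uIoc_of_le hx'.1.le] at ht'
    rw [uIoc_of_le hab]
    exact ⟨ht'.1, ht'.2.trans hx'.2.le⟩
  refine ⟨⟨hU.toLp _, _, hw⟩, hU.coeFn_toLp, ?_⟩
  rw [← weakDeriv_unique ⟨hU.toLp _, _, hw⟩ _ hw]
  exact hcoe

/-! ### Linearity, the scalar product and orthogonal projectors. -/

lemma HasWeakDeriv.add {a b : ℝ} {u v g k : L2 a b} (hg : HasWeakDeriv a b u g)
    (hk : HasWeakDeriv a b v k) : HasWeakDeriv a b (u + v : L2 a b) (g + k : L2 a b) := by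
  intro φ h1 h2 h3
  have hd : Continuous (deriv φ) := h1.continuous_deriv (by simp)
  have e1 : ∫ x in Ioo a b, (u + v : L2 a b) x * deriv φ x
      = ∫ x in Ioo a b, (u x * deriv φ x + v x * deriv φ x) := by
    refine integral_congr_ae ?_
    filter_upwards [Lp.coeFn_add u v] with x hx
    rw [hx, Pi.add_apply, add_mul]
  have e2 : ∫ x in Ioo a b, (g + k : L2 a b) x * φ x
      = ∫ x in Ioo a b, (g x * φ x + k x * φ x) := by
    refine integral_congr_ae ?_
    filter_upwards [Lp.coeFn_add g k] with x hx
    rw [hx, Pi.add_apply, add_mul]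
  rw [e1, e2, integral_add (integrable_mul_test u hd h2.deriv) (integrable_mul_test v hd h2.deriv),
    integral_add (integrable_mul_test g h1.continuous h2)
      (integrable_mul_test k h1.continuous h2), hg φ h1 h2 h3, hk φ h1 h2 h3]
  ring

lemma HasWeakDeriv.smul {a b : ℝ} {u g : L2 a b} (c : ℝ) (hg : HasWeakDeriv a b u g) :
    HasWeakDeriv a b (c • u : L2 a b) (c • g : L2 a b) := by
  intro φ h1 h2 h3
  have e1 : ∫ x in Ioo a b, (c • u : L2 a b) x * deriv φ x
      = ∫ x in Ioo a b, c * (u x * deriv φ x) := by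
    refine integral_congr_ae ?_
    filter_upwards [Lp.coeFn_smul c u] with x hx
    rw [hx, Pi.smul_apply, smul_eq_mul, mul_assoc]
  have e2 : ∫ x in Ioo a b, (c • g : L2 a b) x * φ x
      = ∫ x in Ioo a b, c * (g x * φ x) := by
    refine integral_congr_ae ?_
    filter_upwards [Lp.coeFn_smul c g] with x hx
    rw [hx, Pi.smul_apply, smul_eq_mul, mul_assoc]
  rw [e1, e2, integral_const_mul, integral_const_mul, hg φ h1 h2 h3]
  ring

/-- The weak derivative as a linear map. -/
noncomputable def weakDerivHom (a b : ℝ) : H1 a b →ₗ[ℝ] L2 a b where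
  toFun := weakDeriv
  map_add' u v := (weakDeriv_unique (u + v) _ ((weakDeriv_spec u).add (weakDeriv_spec v))).symm
  map_smul' c u := (weakDeriv_unique (c • u) _ ((weakDeriv_spec u).smul c)).symm

lemma weakDeriv_sub {a b : ℝ} (u v : H1 a b) : weakDeriv (u - v) = weakDeriv u - weakDeriv v :=
  (weakDerivHom a b).map_sub u v

/-- The integral over `(a, b)` as a linear functional. -/
noncomputable def integralHom (a b : ℝ) : H1 a b →ₗ[ℝ] ℝ where
  toFun u := ∫ x in Ioo a b, (u : L2 a b) x
  map_add' u v := by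
    rw [← integral_add (L2.integrableOn _) (L2.integrableOn _)]
    refine integral_congr_ae ?_
    filter_upwards [Lp.coeFn_add (u : L2 a b) (v : L2 a b)] with x hx
    exact hx
  map_smul' c u := by
    rw [RingHom.id_apply, smul_eq_mul, ← integral_const_mul]
    refine integral_congr_ae ?_
    filter_upwards [Lp.coeFn_smul c (u : L2 a b)] with x hx
    exact hx

lemma L2.inner_eq {a b : ℝ} (f g : L2 a b) :
    inner ℝ f g = ∫ x in Ioo a b, f x * g x := by
  rw [MeasureTheory.L2.inner_def]
  refine integral_congr_ae (Eventually.of_forall fun x => ?_)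
  simp [mul_comm]

lemma L2.norm_sq_eq {a b : ℝ} (f : L2 a b) : ‖f‖ ^ 2 = ∫ x in Ioo a b, f x ^ 2 := by
  rw [← real_inner_self_eq_norm_sq, L2.inner_eq]
  simp only [sq]

lemma circInner_eq {a b : ℝ} (u v : H1 a b) : circInner u v =
    inner ℝ (weakDerivHom a b u) (weakDerivHom a b v)
      + 1 / (b - a) * integralHom a b u * integralHom a b v := by
  rw [L2.inner_eq]; rfl

/-- The scalar product `circInner` as a bilinear map. -/
noncomputable def circForm (a b : ℝ) : H1 a b →ₗ[ℝ] H1 a b →ₗ[ℝ] ℝ :=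
  LinearMap.mk₂ ℝ circInner
    (fun u u' v => by simp only [circInner_eq, map_add, inner_add_left]; ring)
    (fun c u v => by simp only [circInner_eq, map_smul, real_inner_smul_left, smul_eq_mul]; ring)
    (fun u v v' => by simp only [circInner_eq, map_add, inner_add_right]; ring)
    (fun c u v => by simp only [circInner_eq, map_smul, real_inner_smul_right, smul_eq_mul]; ring)

lemma circForm_apply {a b : ℝ} (u v : H1 a b) : circForm a b u v = circInner u v := rfl

lemma circInner_sub_left {a b : ℝ} (u u' v : H1 a b) :
    circInner (u - u') v = circInner u v - circInner u' v := by
  simp only [← circForm_apply, map_sub, LinearMap.sub_apply]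

/-- Both summands are nonnegative, so both vanish: the first makes `u` constant almost everywhere,
the second makes the constant zero. -/
lemma eq_zero_of_circInner_self {a b : ℝ} (hab : a < b) {u : H1 a b} (h : circInner u u = 0) :
    u = 0 := by
  rw [circInner_eq, real_inner_self_eq_norm_sq] at h
  have hpos : 0 < 1 / (b - a) := one_div_pos.2 (sub_pos.2 hab)
  have h1 : 0 ≤ 1 / (b - a) * integralHom a b u ^ 2 := by positivity
  have hd : weakDerivHom a b u = 0 := by
    rw [← norm_eq_zero, ← sq_eq_zero_iff]
    nlinarith [sq_nonneg ‖weakDerivHom a b u‖]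
  have hi : integralHom a b u = 0 := by
    rw [hd, norm_zero] at h
    rw [← sq_eq_zero_iff]
    refine (mul_eq_zero.1 ?_).resolve_left hpos.ne'
    linarith
  obtain ⟨c, hc⟩ := H1.exists_ae_eq hab u
  have hd0 : (weakDeriv u : ℝ → ℝ) =ᵐ[volume.restrict (Ioo a b)] 0 := by
    rw [show weakDeriv u = 0 from hd]
    exact Lp.coeFn_zero _ _ _
  have hc' : ∀ᵐ x ∂volume.restrict (Ioo a b), (u : L2 a b) x = c := by
    filter_upwards [hc, ae_restrict_mem measurableSet_Ioo] with x hx hx'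
    rw [hx, intervalIntegral.integral_zero_ae, add_zero]
    filter_upwards [ae_uIoc_of_ae_Ioo hab.le hd0] with t ht ht'
    refine ht ?_
    rw [uIoc_of_le hx'.1.le] at ht'
    rw [uIoc_of_le hab.le]
    exact ⟨ht'.1, ht'.2.trans hx'.2.le⟩
  have hc0 : c = 0 := by
    have : integralHom a b u = ∫ x in Ioo a b, c := integral_congr_ae hc'
    rw [hi, setIntegral_Ioo hab.le, intervalIntegral.integral_const, smul_eq_mul] at this
    exact (mul_eq_zero.1 this.symm).resolve_left (sub_pos.2 hab).ne'
  refine Subtype.ext ?_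
  refine (Lp.eq_zero_iff_ae_eq_zero).2 ?_
  filter_upwards [hc'] with x hx
  rw [hx, hc0]; rfl

/-- The orthogonal projector onto a finite-dimensional subspace exists and is unique. -/
lemma existsUnique_isCircProjector {a b : ℝ} (hab : a < b) (S : Submodule ℝ (H1 a b))
    [FiniteDimensional ℝ S] : ∃! P : H1 a b →ₗ[ℝ] H1 a b, IsCircProjector S P := by
  -- Definiteness makes `D` injective on `S`, hence an isomorphism onto the dual by dimension count.
  -- The projection of `u` is the element of `S` representing `D u`, so completeness of `H1` plays
  -- no role.
  let D : H1 a b →ₗ[ℝ] Module.Dual ℝ S := (circForm a b).compl₂ S.subtype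
  have hinj : Function.Injective (D ∘ₗ S.subtype) := by
    rw [← LinearMap.ker_eq_bot, LinearMap.ker_eq_bot']
    intro s hs
    have : circInner (s : H1 a b) s = 0 := LinearMap.congr_fun hs s
    exact Subtype.ext (eq_zero_of_circInner_self hab this)
  let e : S ≃ₗ[ℝ] Module.Dual ℝ S :=
    LinearMap.linearEquivOfInjective (D ∘ₗ S.subtype) hinj Subspace.dual_finrank_eq.symm
  have he : ∀ u : H1 a b, ∀ v ∈ S, circInner (e.symm (D u) : H1 a b) v = circInner u v := by
    intro u v hv
    have : e (e.symm (D u)) = D u := e.apply_symm_apply _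
    exact LinearMap.congr_fun this ⟨v, hv⟩
  refine ⟨S.subtype ∘ₗ e.symm.toLinearMap ∘ₗ D, ⟨fun u => (e.symm (D u)).2, fun u v hv => ?_⟩,
    fun P hP => LinearMap.ext fun u => ?_⟩
  · rw [circInner_sub_left, sub_eq_zero]
    exact (he u v hv).symm
  · rw [← sub_eq_zero]
    refine eq_zero_of_circInner_self hab ?_
    have hm : P u - (e.symm (D u) : H1 a b) ∈ S := S.sub_mem (hP.mem u) (e.symm (D u)).2
    have h1 := hP.orth u _ hm
    have h2 := he u _ hm
    rw [circInner_sub_left] at h1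
    change circInner (P u - (e.symm (D u) : H1 a b)) (P u - (e.symm (D u) : H1 a b)) = 0
    rw [circInner_sub_left]
    linarith

/-! ### Finite dimension of the spline spaces. -/

/-- The `i`-th open cell of the uniform grid with `N` cells on `(a, b)`. -/
def cell (a b : ℝ) (N i : ℕ) : Set ℝ :=
  Ioo (a + i * ((b - a) / N)) (a + (i + 1) * ((b - a) / N))

lemma exists_mem_cell {a b x : ℝ} {N : ℕ} (hN : 0 < N) (hx : x ∈ Ioo a b)
    (hx' : ∀ i : ℕ, x ≠ a + i * ((b - a) / N)) : ∃ i < N, x ∈ cell a b N i := by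
  have hab : 0 < b - a := by linarith [hx.1, hx.2]
  have hN' : (0 : ℝ) < N := by exact_mod_cast hN
  set d := (b - a) / N with hd
  have hdpos : 0 < d := by positivity
  have hdN : N * d = b - a := by rw [hd]; field_simp
  have h0 : 0 ≤ (x - a) / d := div_nonneg (by linarith [hx.1]) hdpos.le
  have h1 := (le_div_iff₀ hdpos).1 (Nat.floor_le h0)
  have h2 := (div_lt_iff₀ hdpos).1 (Nat.lt_floor_add_one ((x - a) / d))
  have h3 := hx' ⌊(x - a) / d⌋₊
  -- The floor gives only a weak lower inequality; it is strict because `x` is not a node.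
  refine ⟨⌊(x - a) / d⌋₊, (Nat.floor_lt h0).2 ?_, lt_of_le_of_ne (by linarith) (Ne.symm h3),
    by linarith⟩
  rw [div_lt_iff₀ hdpos, hdN]
  linarith [hx.2]

lemma ae_exists_mem_cell {a b : ℝ} {N : ℕ} (hN : 0 < N) :
    ∀ᵐ x ∂volume.restrict (Ioo a b), ∃ i < N, x ∈ cell a b N i := by
  have : ∀ᵐ x, x ∉ range fun i : ℕ => a + i * ((b - a) / N) :=
    (countable_range _).ae_notMem _
  filter_upwards [ae_restrict_of_ae this, ae_restrict_mem measurableSet_Ioo] with x h1 h2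
  exact exists_mem_cell hN h2 fun i h => h1 ⟨i, h.symm⟩

lemma cell_index_unique {a b x : ℝ} {N i j : ℕ} (hab : a ≤ b) (hi : x ∈ cell a b N i)
    (hj : x ∈ cell a b N j) : i = j := by
  have hd : 0 ≤ (b - a) / N := div_nonneg (sub_nonneg.2 hab) (Nat.cast_nonneg _)
  by_contra hne
  rcases Nat.lt_or_gt_of_ne hne with h | h
  · have : (i + 1 : ℝ) ≤ j := by exact_mod_cast h
    nlinarith [hi.2, hj.1, mul_le_mul_of_nonneg_right this hd]
  · have : (j + 1 : ℝ) ≤ i := by exact_mod_cast h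
    nlinarith [hj.2, hi.1, mul_le_mul_of_nonneg_right this hd]

lemma memLp_indicator_cell_pow (a b : ℝ) (N i k : ℕ) :
    MemLp ((cell a b N i).indicator fun x => x ^ k) 2 (volume.restrict (Ioo a b)) := by
  refine MemLp.indicator measurableSet_Ioo ?_
  refine MemLp.of_bound (by fun_prop) (max |a| |b| ^ k) ?_
  refine (ae_restrict_iff' measurableSet_Ioo).2 (Eventually.of_forall fun x hx => ?_)
  rw [Real.norm_eq_abs, abs_pow]
  exact pow_le_pow_left₀ (abs_nonneg _) (abs_le_max_abs_abs hx.1.le hx.2.le) k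

/-- The monomial `x ^ k` on the `i`-th cell, extended by zero, as an element of `L²(a, b)`. -/
noncomputable def cellMonomial (a b : ℝ) (N i k : ℕ) : L2 a b :=
  (memLp_indicator_cell_pow a b N i k).toLp

/-- Smoothness is irrelevant here: any piecewise polynomial is, off the nodes, a combination of the
`N (p + 1)` monomials supported on single cells. -/
lemma IsSpline.eq_sum_cellMonomial {p N : ℕ} {a b : ℝ} (hN : 0 < N) (hab : a ≤ b) {f : ℝ → ℝ}
    (hf : IsSpline p N a b f) {u : L2 a b} (hu : u =ᵐ[volume.restrict (Ioo a b)] f) :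
    u ∈ Submodule.span ℝ (range fun ik : Fin N × Fin (p + 1) => cellMonomial a b N ik.1 ik.2) := by
  choose! q hq hq' using hf.2
  have : u = ∑ ik : Fin N × Fin (p + 1),
      (q ik.1).coeff ik.2 • cellMonomial a b N ik.1 ik.2 := by
    refine Lp.ext ?_
    have hs : ∀ᵐ x ∂volume.restrict (Ioo a b), ∀ ik : Fin N × Fin (p + 1),
        ((q ik.1).coeff ik.2 • cellMonomial a b N ik.1 ik.2 : L2 a b) x
          = (q ik.1).coeff ik.2 * (cell a b N ik.1).indicator (fun x => x ^ (ik.2 : ℕ)) x := by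
      rw [ae_all_iff]
      intro ik
      filter_upwards [Lp.coeFn_smul ((q ik.1).coeff ik.2) (cellMonomial a b N ik.1 ik.2),
        (memLp_indicator_cell_pow a b N ik.1 ik.2).coeFn_toLp] with x h1 h2
      rw [h1, Pi.smul_apply, smul_eq_mul]
      congr 1
    have hsum := Lp.coeFn_finsetSum (Finset.univ : Finset (Fin N × Fin (p + 1)))
      fun ik => (q ik.1).coeff ik.2 • cellMonomial a b N ik.1 ik.2
    filter_upwards [hu, hs, hsum, ae_exists_mem_cell hN] with x h1 h2 h3 h4
    obtain ⟨i, hi, hx⟩ := h4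
    rw [h1, h3, hq' i hi x hx, Finset.sum_apply, Fintype.sum_prod_type]
    rw [Finset.sum_eq_single_of_mem ⟨i, hi⟩ (Finset.mem_univ _)]
    · rw [Polynomial.eval_eq_sum_range' (Nat.lt_succ_of_le (hq i hi)), Finset.sum_range]
      refine Finset.sum_congr rfl fun k _ => ?_
      rw [h2, indicator_of_mem hx]
    · intro j _ hj
      refine Finset.sum_eq_zero fun k _ => ?_
      rw [h2, indicator_of_notMem, mul_zero]
      intro hxj
      exact hj (Fin.ext (cell_index_unique hab hxj hx))
  rw [this]
  exact Submodule.sum_mem _ fun ik _ => Submodule.smul_mem _ _ (Submodule.subset_span ⟨ik, rfl⟩)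

lemma finiteDimensional_of_isSpline {p N : ℕ} {a b : ℝ} (hN : 0 < N) (hab : a ≤ b)
    {S : Submodule ℝ (H1 a b)} (h : ∀ u ∈ S, ∃ f, IsSpline p N a b f ∧
      ((u : L2 a b) : ℝ → ℝ) =ᵐ[volume.restrict (Ioo a b)] f) : FiniteDimensional ℝ S := by
  let W := Submodule.span ℝ
    (range fun ik : Fin N × Fin (p + 1) => cellMonomial a b N ik.1 ik.2)
  have : FiniteDimensional ℝ W := FiniteDimensional.span_of_finite ℝ (finite_range _)
  let F : S →ₗ[ℝ] W := ((H1 a b).subtype ∘ₗ S.subtype).codRestrict W fun u => by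
    obtain ⟨f, hf, hf'⟩ := h u u.2
    exact hf.eq_sum_cellMonomial hN hab hf'
  refine FiniteDimensional.of_injective F fun u v huv => ?_
  exact Subtype.ext (Subtype.ext (congrArg (fun w : W => (w : L2 a b)) huv))

lemma finiteDimensional_splineTilde {p n : ℕ} (hn : 0 < n) :
    FiniteDimensional ℝ (splineTilde p n) :=
  finiteDimensional_of_isSpline hn zero_le_one fun _ ⟨f, h1, _, h2⟩ => ⟨f, h1, h2⟩

lemma finiteDimensional_splinePeriodic {p n : ℕ} (hn : 0 < n) :
    FiniteDimensional ℝ (splinePeriodic p n) :=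
  finiteDimensional_of_isSpline (Nat.mul_pos two_pos hn) (by norm_num)
    fun _ ⟨f, h1, _, h2⟩ => ⟨f, h1, h2⟩

/-! ### Adjoint primitives and the approximation estimate. -/

/-- The primitive on `(0, 1)` with mean value zero (`true`), and the primitive vanishing at both
ends after subtraction of the mean value of the integrand (`false`). -/
noncomputable def prim : Bool → (ℝ → ℝ) → ℝ → ℝ
  | true, f => fun x => (∫ t in 0..x, f t) - ∫ y in (0 : ℝ)..1, ∫ t in 0..y, f t
  | false, f => fun x => (∫ t in 0..x, f t) - x * ∫ t in (0 : ℝ)..1, f t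

lemma continuousOn_primitive {a b : ℝ} {f : ℝ → ℝ} (hf : IntervalIntegrable f volume a b) :
    ContinuousOn (fun x => ∫ t in a..x, f t) (uIcc a b) :=
  intervalIntegral.continuousOn_primitive_interval' hf left_mem_uIcc

lemma continuousOn_prim {f : ℝ → ℝ} (hf : IntervalIntegrable f volume 0 1) (b : Bool) :
    ContinuousOn (prim b f) (uIcc 0 1) := by
  cases b
  · exact (continuousOn_primitive hf).sub (by fun_prop)
  · exact (continuousOn_primitive hf).sub continuousOn_const

/-- Integrating by parts against `g` and against the constant 1 produces the same boundary term, the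
product of the two total integrals, and the normalisations of the primitives are such that it
cancels. -/
lemma integral_prim_mul_aux {f g : ℝ → ℝ} (hf : IntervalIntegrable f volume 0 1)
    (hg : IntervalIntegrable g volume 0 1) :
    ∫ x in (0 : ℝ)..1, prim true f x * g x = -∫ x in (0 : ℝ)..1, f x * prim false g x := by
  have h1 := integral_mul_primitive hf hg
  have h2 := integral_mul_primitive hf (intervalIntegrable_const (c := (1 : ℝ)))
  simp only [intervalIntegral.integral_const, smul_eq_mul, sub_zero, mul_one] at h2
  have e1 : ∫ x in (0 : ℝ)..1, prim true f x * g x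
      = (∫ x in (0 : ℝ)..1, (∫ t in 0..x, f t) * g x)
        - (∫ y in (0 : ℝ)..1, ∫ t in 0..y, f t) * ∫ x in (0 : ℝ)..1, g x := by
    rw [← intervalIntegral.integral_const_mul, ← intervalIntegral.integral_sub
      (hg.continuousOn_mul (continuousOn_primitive hf)) (hg.const_mul _)]
    simp only [prim, sub_mul]
  have e2 : ∫ x in (0 : ℝ)..1, f x * prim false g x
      = (∫ x in (0 : ℝ)..1, f x * ∫ t in 0..x, g t)
        - (∫ x in (0 : ℝ)..1, f x * x) * ∫ x in (0 : ℝ)..1, g x := by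
    have hfx : IntervalIntegrable (fun x => f x * x) volume 0 1 :=
      hf.mul_continuousOn continuousOn_id
    rw [← intervalIntegral.integral_mul_const, ← intervalIntegral.integral_sub
      (hf.mul_continuousOn (continuousOn_primitive hg)) (hfx.mul_const _)]
    simp only [prim, mul_sub, mul_assoc]
  rw [e1, e2, h1, h2]
  ring

/-- The two primitives are, up to the sign, adjoint to each other. -/
lemma integral_prim_mul {f g : ℝ → ℝ} (hf : IntervalIntegrable f volume 0 1)
    (hg : IntervalIntegrable g volume 0 1) (b : Bool) :
    ∫ x in (0 : ℝ)..1, prim b f x * g x = -∫ x in (0 : ℝ)..1, f x * prim (!b) g x := by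
  cases b
  · have := integral_prim_mul_aux hg hf
    simp only [Bool.not_false]
    simp only [mul_comm (f _), mul_comm (prim false f _)]
    linarith
  · exact integral_prim_mul_aux hf hg

/-- Splines generated from the piecewise constants by repeated integration with the boundary
conditions of alternating type. -/
def splineFamily (n : ℕ) : Bool → ℕ → Set (ℝ → ℝ)
  | _, 0 => {f | ∃ i < n, f = (cell 0 1 n i).indicator 1}
  | b, q + 1 => prim b '' splineFamily n (!b) q

/-- Cauchy–Schwarz against the constant 1, read off from the nonnegative integral of `((d - c) f -
A)²`. -/
lemma sq_integral_le {c d : ℝ} (hcd : c ≤ d) {f : ℝ → ℝ} (hf : IntervalIntegrable f volume c d)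
    (hf2 : IntervalIntegrable (fun x => f x ^ 2) volume c d) :
    (∫ x in c..d, f x) ^ 2 ≤ (d - c) * ∫ x in c..d, f x ^ 2 := by
  rcases hcd.eq_or_lt with rfl | hlt
  · simp
  set A := ∫ x in c..d, f x with hA
  have h0 : 0 ≤ ∫ x in c..d, ((d - c) * f x - A) ^ 2 :=
    intervalIntegral.integral_nonneg hcd fun x _ => sq_nonneg _
  have h1 : ∫ x in c..d, ((d - c) * f x - A) ^ 2
      = (d - c) ^ 2 * (∫ x in c..d, f x ^ 2) - 2 * (d - c) * A * A + (d - c) * A ^ 2 := by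
    have e : ∀ x, ((d - c) * f x - A) ^ 2
        = (d - c) ^ 2 * f x ^ 2 - 2 * (d - c) * A * f x + A ^ 2 := fun x => by ring
    simp only [e]
    rw [intervalIntegral.integral_add ((hf2.const_mul _).sub (hf.const_mul _))
      intervalIntegrable_const, intervalIntegral.integral_sub (hf2.const_mul _) (hf.const_mul _),
      intervalIntegral.integral_const_mul, intervalIntegral.integral_const_mul,
      intervalIntegral.integral_const, smul_eq_mul]
  have hp : 0 < d - c := sub_pos.2 hlt
  have h2 : 0 ≤ (d - c) * ((d - c) * (∫ x in c..d, f x ^ 2) - A ^ 2) := by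
    rw [h1] at h0; nlinarith
  linarith [nonneg_of_mul_nonneg_right h2 hp]

lemma MemLp.intervalIntegrable {f : ℝ → ℝ} (hf : MemLp f 2 (volume.restrict (Ioo 0 1))) :
    IntervalIntegrable f volume 0 1 :=
  intervalIntegrable_of_Ioo zero_le_one (hf.integrable (by norm_num))

lemma MemLp.intervalIntegrable_mul {f g : ℝ → ℝ} (hf : MemLp f 2 (volume.restrict (Ioo 0 1)))
    (hg : MemLp g 2 (volume.restrict (Ioo 0 1))) :
    IntervalIntegrable (fun x => f x * g x) volume 0 1 :=
  intervalIntegrable_of_Ioo zero_le_one (hf.integrable_mul hg)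

lemma memLp_of_continuousOn {f : ℝ → ℝ} (hf : ContinuousOn f (uIcc 0 1)) :
    MemLp f 2 (volume.restrict (Ioo 0 1)) := by
  rw [uIcc_of_le zero_le_one] at hf
  obtain ⟨C, hC⟩ := isCompact_Icc.exists_bound_of_continuousOn hf
  refine MemLp.of_bound ((hf.mono Ioo_subset_Icc_self).aestronglyMeasurable
    measurableSet_Ioo) C ?_
  exact (ae_restrict_iff' measurableSet_Ioo).2
    (Eventually.of_forall fun x hx => hC x (Ioo_subset_Icc_self hx))

lemma cell_zero_one (n i : ℕ) : cell 0 1 n i = Ioo (i * (1 / n : ℝ)) ((i + 1) * (1 / n : ℝ)) := by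
  simp [cell]

lemma cell_subset {n i : ℕ} (hi : i < n) : cell 0 1 n i ⊆ Ioo 0 1 := by
  have hn : (0 : ℝ) < n := by exact_mod_cast (Nat.zero_le i).trans_lt hi
  have h1 : (i + 1 : ℝ) ≤ n := by exact_mod_cast hi
  rw [cell_zero_one]
  refine Ioo_subset_Ioo (by positivity) ?_
  rw [mul_one_div, div_le_one hn]
  exact h1

/-- With mean zero on each cell, the primitive vanishes at all nodes. Within a cell it is an
integral from the left node, so Cauchy–Schwarz bounds its square by `δ` times the integral of `f²`
over the cell. Integrating over the cell supplies the second factor `δ`. -/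
lemma integral_primitive_sq_le {n : ℕ} (hn : 0 < n) {f : ℝ → ℝ}
    (hf : MemLp f 2 (volume.restrict (Ioo 0 1)))
    (h : ∀ i < n, ∫ x in cell 0 1 n i, f x = 0) :
    ∫ x in (0 : ℝ)..1, (∫ t in 0..x, f t) ^ 2 ≤ (1 / n : ℝ) ^ 2 * ∫ x in (0 : ℝ)..1, f x ^ 2 := by
  have hn' : (0 : ℝ) < n := by exact_mod_cast hn
  set δ : ℝ := 1 / n with hδ
  have hδ0 : 0 < δ := by positivity
  have hnδ : (n : ℝ) * δ = 1 := by rw [hδ]; field_simp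
  have hfi := MemLp.intervalIntegrable hf
  have hf2 : IntervalIntegrable (fun x => f x ^ 2) volume 0 1 := by
    simpa only [sq] using MemLp.intervalIntegrable_mul hf hf
  have hF2 : IntervalIntegrable (fun x => (∫ t in 0..x, f t) ^ 2) volume 0 1 :=
    ((continuousOn_primitive hfi).pow 2).intervalIntegrable
  let a : ℕ → ℝ := fun i => i * δ
  have ha : ∀ i, a (i + 1) = (i + 1) * δ := fun i => by simp [a]
  have ha0 : a 0 = 0 := by simp [a]
  have han : a n = 1 := hnδ
  have hle : ∀ i, a i ≤ a (i + 1) := fun i => by rw [ha]; simp only [a]; linarith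
  have hdiff : ∀ i, a (i + 1) - a i = δ := fun i => by rw [ha]; simp only [a]; ring
  have ha01 : ∀ i ≤ n, a i ∈ Icc (0 : ℝ) 1 := fun i hi => by
    refine ⟨by positivity, ?_⟩
    rw [← hnδ]
    exact mul_le_mul_of_nonneg_right (by exact_mod_cast hi) hδ0.le
  have hsub : ∀ {x y : ℝ}, x ∈ Icc (0 : ℝ) 1 → y ∈ Icc (0 : ℝ) 1 → uIcc x y ⊆ uIcc 0 1 :=
    fun hx hy => by
      rw [uIcc_of_le (zero_le_one' ℝ)]
      exact OrdConnected.uIcc_subset ordConnected_Icc hx hy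
  have h01 : (0 : ℝ) ∈ Icc (0 : ℝ) 1 := ⟨le_rfl, zero_le_one⟩
  have hnode : ∀ i ≤ n, ∫ t in 0..a i, f t = 0 := by
    intro i
    induction i with
    | zero => intro _; simp [ha0]
    | succ i ih =>
      intro hi
      have hi' : i ≤ n := (Nat.le_succ i).trans hi
      rw [← intervalIntegral.integral_add_adjacent_intervals
        (hfi.mono_set (hsub h01 (ha01 i hi'))) (hfi.mono_set (hsub (ha01 i hi') (ha01 _ hi))),
        ih hi', zero_add, ← setIntegral_Ioo (hle i), ha]
      have := h i hi
      rwa [cell_zero_one] at this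
  have hcell : ∀ i < n, ∫ x in a i..a (i + 1), (∫ t in 0..x, f t) ^ 2
      ≤ δ ^ 2 * ∫ x in a i..a (i + 1), f x ^ 2 := by
    intro i hi
    have hs := hsub (ha01 i hi.le) (ha01 (i + 1) hi)
    have hb : ∀ x ∈ Icc (a i) (a (i + 1)), (∫ t in 0..x, f t) ^ 2
        ≤ δ * ∫ x in a i..a (i + 1), f x ^ 2 := by
      intro x hx
      have hx01 : x ∈ Icc (0 : ℝ) 1 :=
        ⟨(ha01 i hi.le).1.trans hx.1, hx.2.trans (ha01 (i + 1) hi).2⟩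
      have hsx := hsub (ha01 i hi.le) hx01
      rw [← intervalIntegral.integral_add_adjacent_intervals
        (hfi.mono_set (hsub h01 (ha01 i hi.le))) (hfi.mono_set hsx), hnode i hi.le, zero_add]
      refine (sq_integral_le hx.1 (hfi.mono_set hsx) (hf2.mono_set hsx)).trans ?_
      have hxδ : x - a i ≤ δ := by linarith [hx.2, hdiff i]
      refine mul_le_mul hxδ ?_ (intervalIntegral.integral_nonneg hx.1 fun _ _ => sq_nonneg _)
        hδ0.le
      exact intervalIntegral.integral_mono_interval le_rfl hx.1 hx.2
        (Eventually.of_forall fun _ => sq_nonneg _) (hf2.mono_set hs)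
    have := intervalIntegral.integral_mono_on (hle i) (hF2.mono_set hs)
      intervalIntegrable_const hb
    rw [intervalIntegral.integral_const, hdiff, smul_eq_mul] at this
    linarith
  have s1 := intervalIntegral.sum_integral_adjacent_intervals (n := n) (a := a)
    fun i hi => hF2.mono_set (hsub (ha01 i hi.le) (ha01 (i + 1) hi))
  have s2 := intervalIntegral.sum_integral_adjacent_intervals (n := n) (a := a)
    fun i hi => hf2.mono_set (hsub (ha01 i hi.le) (ha01 (i + 1) hi))
  rw [ha0, han] at s1 s2
  rw [← s1, ← s2, Finset.mul_sum]
  exact Finset.sum_le_sum fun i hi => hcell i (Finset.mem_range.1 hi)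

/-- Neither normalisation increases the norm of the plain primitive: for `false` the total integral
of `f` is zero, so nothing is subtracted; for `true` subtracting the mean lowers the `L²` norm. -/
lemma integral_prim_sq_le_of_cells {n : ℕ} (hn : 0 < n) {f : ℝ → ℝ}
    (hf : MemLp f 2 (volume.restrict (Ioo 0 1)))
    (h : ∀ i < n, ∫ x in cell 0 1 n i, f x = 0) (b : Bool) :
    ∫ x in (0 : ℝ)..1, prim b f x ^ 2 ≤ (1 / n : ℝ) ^ 2 * ∫ x in (0 : ℝ)..1, f x ^ 2 := by
  have hfi := MemLp.intervalIntegrable hf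
  refine le_trans ?_ (integral_primitive_sq_le hn hf h)
  cases b
  · have h0 : ∫ t in (0 : ℝ)..1, f t = 0 := by
      rw [← setIntegral_Ioo zero_le_one]
      have hU : (⋃ i ∈ Finset.range n, cell 0 1 n i) =ᵐ[volume] Ioo (0 : ℝ) 1 := by
        have h1 := (ae_restrict_iff' measurableSet_Ioo).1
          (ae_exists_mem_cell (a := 0) (b := 1) hn)
        filter_upwards [h1] with x hx
        refine propext ⟨fun hx' => ?_, fun hx' => ?_⟩
        · obtain ⟨i, hi, hxi⟩ := mem_iUnion₂.1 hx'
          exact cell_subset (Finset.mem_range.1 hi) hxi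
        · obtain ⟨i, hi, hxi⟩ := hx hx'
          exact mem_iUnion₂.2 ⟨i, Finset.mem_range.2 hi, hxi⟩
      rw [← setIntegral_congr_set hU, integral_biUnion_finset (s := cell 0 1 n) _
        (fun _ _ => measurableSet_Ioo)]
      · exact Finset.sum_eq_zero fun i hi => h i (Finset.mem_range.1 hi)
      · intro i _ j _ hij
        exact disjoint_left.2 fun x hi hj => hij (cell_index_unique zero_le_one hi hj)
      · exact fun i hi => (hf.integrable (by norm_num)).mono_measure
          (Measure.restrict_mono (cell_subset (Finset.mem_range.1 hi)) le_rfl)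
    simp only [prim, h0, mul_zero, sub_zero, le_refl]
  · set m := ∫ y in (0 : ℝ)..1, ∫ t in 0..y, f t with hm
    have hF := continuousOn_primitive hfi
    have e : ∀ x, prim true f x ^ 2
        = (∫ t in 0..x, f t) ^ 2 - 2 * m * (∫ t in 0..x, f t) + m ^ 2 := fun x => by
      simp only [prim]; ring
    simp only [e]
    have hF2 : IntervalIntegrable (fun x => (∫ t in 0..x, f t) ^ 2) volume 0 1 :=
      (hF.pow 2).intervalIntegrable
    rw [intervalIntegral.integral_add (hF2.sub
      (hF.intervalIntegrable.const_mul _)) intervalIntegrable_const,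
      intervalIntegral.integral_sub hF2
      (hF.intervalIntegrable.const_mul _), intervalIntegral.integral_const_mul, ← hm,
      intervalIntegral.integral_const, smul_eq_mul]
    nlinarith [sq_nonneg m]

lemma continuous_prim {f : ℝ → ℝ} (hf : ∀ x y, IntervalIntegrable f volume x y) (b : Bool) :
    Continuous (prim b f) := by
  cases b
  · exact (intervalIntegral.continuous_primitive hf 0).sub (by fun_prop)
  · exact (intervalIntegral.continuous_primitive hf 0).sub continuous_const

lemma intervalIntegrable_of_mem_splineFamily {n q : ℕ} : ∀ {b : Bool} {f : ℝ → ℝ},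
    f ∈ splineFamily n b q → ∀ x y, IntervalIntegrable f volume x y := by
  induction q with
  | zero =>
    rintro b f ⟨i, _, rfl⟩ x y
    refine Integrable.intervalIntegrable ?_
    refine (integrable_indicator_iff measurableSet_Ioo).2 (integrableOn_const ?_)
    simp
  | succ q ih =>
    rintro b f ⟨g, hg, rfl⟩ x y
    exact (continuous_prim (ih hg) b).intervalIntegrable x y

lemma continuous_of_mem_splineFamily {n q : ℕ} {b : Bool} {f : ℝ → ℝ}
    (hf : f ∈ splineFamily n b (q + 1)) : Continuous f := by
  obtain ⟨g, hg, rfl⟩ := hf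
  exact continuous_prim (intervalIntegrable_of_mem_splineFamily hg) b

lemma memLp_of_mem_splineFamily {n q : ℕ} {b : Bool} {f : ℝ → ℝ}
    (hf : f ∈ splineFamily n b q) : MemLp f 2 (volume.restrict (Ioo 0 1)) := by
  cases q with
  | zero =>
    obtain ⟨i, _, rfl⟩ := hf
    exact (memLp_const (1 : ℝ)).indicator measurableSet_Ioo
  | succ q => exact memLp_of_continuousOn (continuous_of_mem_splineFamily hf).continuousOn

/-- The primitive of a function orthogonal to the splines of one type is small. -/
lemma integral_prim_sq_le {n : ℕ} (hn : 0 < n) (q : ℕ) : ∀ (b : Bool) {f : ℝ → ℝ},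
    MemLp f 2 (volume.restrict (Ioo 0 1)) →
    (∀ d ∈ splineFamily n b q, ∫ x in (0 : ℝ)..1, f x * d x = 0) →
    ∫ x in (0 : ℝ)..1, prim (!b) f x ^ 2 ≤ (1 / n : ℝ) ^ 2 * ∫ x in (0 : ℝ)..1, f x ^ 2 := by
  induction q with
  | zero =>
    intro b f hf h
    -- Orthogonality to the indicator of a cell is vanishing of the integral over it.
    refine integral_prim_sq_le_of_cells hn hf (fun i hi => ?_) _
    refine Eq.trans ?_ (h _ ⟨i, hi, rfl⟩)
    have e : ∀ x, f x * (cell 0 1 n i).indicator 1 x = (cell 0 1 n i).indicator f x := fun x => by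
      by_cases hx : x ∈ cell 0 1 n i <;> simp [hx]
    simp only [e]
    rw [← setIntegral_Ioo zero_le_one, setIntegral_indicator (by exact measurableSet_Ioo),
      inter_eq_right.2 (cell_subset hi)]
  | succ q ih =>
    intro b f hf h
    have hfi := MemLp.intervalIntegrable hf
    have hs := continuousOn_prim hfi (!b)
    have hsL := memLp_of_continuousOn hs
    have hr := continuousOn_prim (MemLp.intervalIntegrable hsL) b
    have hrL := memLp_of_continuousOn hr
    -- Adjointness turns `(s, d)` into `-(f, prim b d)`, and `prim b d` lies in the family to which
    -- `f` is orthogonal.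
    have h1 := ih (!b) hsL fun d hd => by
      rw [integral_prim_mul hfi (intervalIntegrable_of_mem_splineFamily hd 0 1), Bool.not_not,
        h _ ⟨d, hd, rfl⟩, neg_zero]
    rw [Bool.not_not] at h1
    have h2 := integral_prim_mul hfi (MemLp.intervalIntegrable hsL) (!b)
    rw [Bool.not_not] at h2
    simp only [← sq] at h2
    set s := prim (!b) f
    set r := prim b s
    set δ : ℝ := 1 / n
    have hδ : 0 < δ := one_div_pos.2 (by exact_mod_cast hn)
    have hff := MemLp.intervalIntegrable_mul hf hf
    have hfr := MemLp.intervalIntegrable_mul hf hrL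
    have hrr := MemLp.intervalIntegrable_mul hrL hrL
    simp only [← sq] at hff hrr
    -- With `(f, r) = -‖s‖²` and `‖r‖ ≤ δ‖s‖`, this square yields `‖s‖² ≤ δ²‖f‖²` in one stroke, in
    -- place of Cauchy–Schwarz followed by a division by `‖s‖`.
    have h3 : 0 ≤ ∫ x in (0 : ℝ)..1, (δ ^ 2 * f x + r x) ^ 2 :=
      intervalIntegral.integral_nonneg zero_le_one fun x _ => sq_nonneg _
    have e : ∀ x, (δ ^ 2 * f x + r x) ^ 2
        = δ ^ 4 * f x ^ 2 + 2 * δ ^ 2 * (f x * r x) + r x ^ 2 := fun x => by ring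
    simp only [e] at h3
    rw [intervalIntegral.integral_add ((hff.const_mul _).add (hfr.const_mul _)) hrr,
      intervalIntegral.integral_add (hff.const_mul _) (hfr.const_mul _),
      intervalIntegral.integral_const_mul, intervalIntegral.integral_const_mul] at h3
    have h4 : 0 ≤ δ ^ 2 * (δ ^ 2 * (∫ x in (0 : ℝ)..1, f x ^ 2)
        - ∫ x in (0 : ℝ)..1, s x ^ 2) := by
      have : ∫ x in (0 : ℝ)..1, f x * r x = -∫ x in (0 : ℝ)..1, s x ^ 2 := by rw [h2, neg_neg]
      rw [this] at h3
      linarith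
    linarith [nonneg_of_mul_nonneg_right h4 (pow_pos hδ 2)]

/-! ### The generated functions are splines with the required boundary conditions. -/

/-- Polynomials have polynomial primitives. -/
lemma exists_derivative_eq (q : ℝ[X]) :
    ∃ r : ℝ[X], r.natDegree ≤ q.natDegree + 1 ∧ Polynomial.derivative r = q := by
  refine ⟨∑ i ∈ Finset.range (q.natDegree + 1),
    Polynomial.C (q.coeff i / (i + 1)) * Polynomial.X ^ (i + 1), ?_, ?_⟩
  · refine Polynomial.natDegree_sum_le_of_forall_le _ _ fun i hi => ?_
    exact (Polynomial.natDegree_C_mul_X_pow_le _ _).trans (Finset.mem_range.1 hi)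
  · conv_rhs => rw [q.as_sum_range_C_mul_X_pow]
    rw [Polynomial.derivative_sum]
    refine Finset.sum_congr rfl fun i _ => ?_
    rw [Polynomial.derivative_C_mul_X_pow]
    congr 2
    · push_cast
      exact div_mul_cancel₀ _ (by positivity)

/-- The constant subtracted from the integrand in `prim`. -/
noncomputable def primConst : Bool → (ℝ → ℝ) → ℝ
  | true, _ => 0
  | false, f => ∫ t in (0 : ℝ)..1, f t

lemma exists_prim_eq (b : Bool) (f : ℝ → ℝ) :
    ∃ c, ∀ x, prim b f x = (∫ t in 0..x, f t) - primConst b f * x - c := by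
  cases b
  · exact ⟨0, fun x => by simp only [prim, primConst]; ring⟩
  · exact ⟨_, fun x => by simp only [prim, primConst]; ring⟩

lemma hasDerivAt_prim {f : ℝ → ℝ} (hf : Continuous f) (b : Bool) (x : ℝ) :
    HasDerivAt (prim b f) (f x - primConst b f) x := by
  obtain ⟨c, hc⟩ := exists_prim_eq b f
  rw [funext hc]
  have h1 := intervalIntegral.integral_hasDerivAt_right (hf.intervalIntegrable 0 x)
    (hf.stronglyMeasurableAtFilter _ _) hf.continuousAt
  simpa using (h1.sub ((hasDerivAt_id x).const_mul (primConst b f))).sub_const c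

lemma deriv_prim {f : ℝ → ℝ} (hf : Continuous f) (b : Bool) :
    deriv (prim b f) = fun x => f x - primConst b f :=
  funext fun x => (hasDerivAt_prim hf b x).deriv

lemma contDiff_of_mem_splineFamily {n q : ℕ} : ∀ {b : Bool} {f : ℝ → ℝ},
    f ∈ splineFamily n b (q + 1) → ContDiff ℝ q f := by
  induction q with
  | zero => exact fun hf => contDiff_zero.2 (continuous_of_mem_splineFamily hf)
  | succ q ih =>
    rintro b f ⟨g, hg, rfl⟩
    have hc := continuous_of_mem_splineFamily hg
    push_cast
    rw [contDiff_succ_iff_deriv]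
    refine ⟨fun x => (hasDerivAt_prim hc b x).differentiableAt, by simp, ?_⟩
    rw [deriv_prim hc]
    exact (ih hg).sub contDiff_const

lemma piecewise_of_mem_splineFamily {n q : ℕ} : ∀ {b : Bool} {f : ℝ → ℝ},
    f ∈ splineFamily n b q → ∀ i < n, ∃ r : ℝ[X], r.natDegree ≤ q ∧
      ∀ x ∈ cell 0 1 n i, f x = r.eval x := by
  induction q with
  | zero =>
    rintro b f ⟨j, hj, rfl⟩ i hi
    by_cases hij : i = j
    · exact ⟨1, by simp, fun x hx => by simp [hij ▸ hx]⟩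
    · refine ⟨0, by simp, fun x hx => ?_⟩
      rw [indicator_of_notMem fun hx' => hij (cell_index_unique zero_le_one hx hx')]
      simp
  | succ q ih =>
    rintro b f ⟨g, hg, rfl⟩ i hi
    obtain ⟨r, hr, hr'⟩ := ih hg i hi
    obtain ⟨R, hR, hR'⟩ := exists_derivative_eq r
    obtain ⟨c, hc⟩ := exists_prim_eq b g
    have hgi := intervalIntegrable_of_mem_splineFamily hg
    -- Any point `m` of the cell serves as base point, so that the integral from `m` to `x` stays
    -- inside the cell.
    rcases (cell 0 1 n i).eq_empty_or_nonempty with he | ⟨m, hm⟩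
    · exact ⟨0, by simp, by simp [he]⟩
    have hprim : ∀ x ∈ cell 0 1 n i,
        ∫ t in 0..x, g t = (∫ t in 0..m, g t) + (R.eval x - R.eval m) := by
      intro x hx
      rw [← intervalIntegral.integral_add_adjacent_intervals (hgi 0 m) (hgi m x)]
      congr 1
      rw [intervalIntegral.integral_congr (g := fun t => r.eval t) fun t ht =>
        hr' t (ordConnected_Ioo.uIcc_subset hm hx ht)]
      refine intervalIntegral.integral_eq_sub_of_hasDerivAt (f := fun t => R.eval t) (fun t _ => ?_)
        (r.continuous.intervalIntegrable _ _)
      rw [← hR']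
      exact R.hasDerivAt t
    refine ⟨R - Polynomial.C (primConst b g) * Polynomial.X
      + Polynomial.C ((∫ t in 0..m, g t) - R.eval m - c), ?_, fun x hx => ?_⟩
    · refine (Polynomial.natDegree_add_C).trans_le ?_
      refine (Polynomial.natDegree_sub_le _ _).trans (max_le (hR.trans (by omega)) ?_)
      exact (Polynomial.natDegree_C_mul_le _ _).trans (Polynomial.natDegree_X_le.trans (by omega))
    · rw [hc, hprim x hx]
      simp
      ring

lemma prim_false_endpoints (f : ℝ → ℝ) : prim false f 0 = 0 ∧ prim false f 1 = 0 := by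
  simp [prim]

/-- Differentiating twice strips one pair `prim true`, `prim false` up to an additive constant,
which the next derivative kills. An odd number of derivatives therefore ends at type `false`; the
degree `k + 1 ≥ 1` makes the result an image of `prim false`, which vanishes at both ends. -/
lemma exists_iteratedDeriv_eq {n : ℕ} (l k : ℕ) : ∀ {f : ℝ → ℝ},
    f ∈ splineFamily n true (2 * l + 2 + k) →
    ∃ d ∈ splineFamily n false (k + 1), iteratedDeriv (2 * l + 1) f = d := by
  induction l with
  | zero =>
    intro f hf
    rw [show 2 * 0 + 2 + k = k + 1 + 1 by ring] at hf
    obtain ⟨d, hd, rfl⟩ := hf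
    refine ⟨d, hd, ?_⟩
    rw [iteratedDeriv_one, deriv_prim (continuous_of_mem_splineFamily hd)]
    simp [primConst]
  | succ l ih =>
    intro f hf
    rw [show 2 * (l + 1) + 2 + k = 2 * l + 1 + k + 1 + 1 + 1 by ring] at hf
    obtain ⟨d, ⟨e, he, rfl⟩, rfl⟩ := hf
    have he' : e ∈ splineFamily n true (2 * l + 2 + k) := by
      rwa [show 2 * l + 2 + k = 2 * l + 1 + k + 1 by ring]
    obtain ⟨d, hd, hd'⟩ := ih he'
    refine ⟨d, hd, ?_⟩
    have hce := continuous_of_mem_splineFamily he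
    have h1 : deriv (prim true (prim false e)) = prim false e := by
      rw [deriv_prim (continuous_prim (intervalIntegrable_of_mem_splineFamily he) false)]
      simp [primConst]
    have h2 : deriv (fun x => e x - primConst false e) = deriv e :=
      funext fun x => deriv_sub_const _
    rw [← hd', show 2 * (l + 1) + 1 = 2 * l + 1 + 1 + 1 by ring]
    rw [iteratedDeriv_succ', Bool.not_true, h1, iteratedDeriv_succ', deriv_prim hce,
      iteratedDeriv_succ', h2, ← iteratedDeriv_succ']

lemma oddDerivsVanish_of_mem_splineFamily {n p : ℕ} {f : ℝ → ℝ}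
    (hf : f ∈ splineFamily n true p) : OddDerivsVanish p 0 1 f := by
  intro l hl
  obtain ⟨k, rfl⟩ : ∃ k, p = 2 * l + 2 + k := ⟨p - (2 * l + 2), by omega⟩
  obtain ⟨d, hd, hd'⟩ := exists_iteratedDeriv_eq l k hf
  rw [hd']
  have hc := continuous_of_mem_splineFamily hd
  obtain ⟨g, hg, rfl⟩ := hd
  constructor
  · have := hc.tendsto 0
    rw [(prim_false_endpoints g).1] at this
    exact this.mono_left nhdsWithin_le_nhds
  · have := hc.tendsto 1
    rw [(prim_false_endpoints g).2] at this
    exact this.mono_left nhdsWithin_le_nhds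

lemma isSpline_of_mem_splineFamily {n q : ℕ} {b : Bool} {f : ℝ → ℝ}
    (hf : f ∈ splineFamily n b (q + 1)) : IsSpline (q + 1) n 0 1 f :=
  ⟨by simpa using (contDiff_of_mem_splineFamily hf).contDiffOn,
    piecewise_of_mem_splineFamily hf⟩

/-- The splines of type `false` are derivatives of elements of `splineTilde`. -/
lemma exists_splineTilde_weakDeriv {n q : ℕ} {d : ℝ → ℝ} (hd : d ∈ splineFamily n false q) :
    ∃ v ∈ splineTilde (q + 1) n, weakDeriv v =ᵐ[volume.restrict (Ioo 0 1)] d := by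
  obtain ⟨v, hv, hv'⟩ := exists_H1_of_primitive zero_le_one (memLp_of_mem_splineFamily hd)
    (-∫ y in (0 : ℝ)..1, ∫ t in 0..y, d t)
  have hm : prim true d ∈ splineFamily n true (q + 1) := ⟨d, hd, rfl⟩
  refine ⟨v, ⟨prim true d, isSpline_of_mem_splineFamily hm,
    oddDerivsVanish_of_mem_splineFamily hm, ?_⟩, hv'⟩
  filter_upwards [hv] with x hx
  rw [hx]
  simp only [prim]
  ring

/-- Testing the orthogonality relation with the constant 1 forces the projection error to have mean
zero. -/
lemma exists_one_splineTilde (p n : ℕ) : ∃ v ∈ splineTilde p n,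
    weakDeriv v = 0 ∧ (v : L2 0 1) =ᵐ[volume.restrict (Ioo 0 1)] fun _ => (1 : ℝ) := by
  obtain ⟨v, hv, hv'⟩ := exists_H1_of_primitive (g := fun _ => 0) (zero_le_one' ℝ)
    (memLp_const 0) 1
  have hv1 : (v : L2 0 1) =ᵐ[volume.restrict (Ioo 0 1)] fun _ => (1 : ℝ) := by
    filter_upwards [hv] with x hx
    simpa using hx
  refine ⟨v, ⟨fun _ => 1, ⟨contDiffOn_const, fun _ _ => ⟨1, by simp, by simp⟩⟩, fun l _ => ?_, hv1⟩,
    (Lp.eq_zero_iff_ae_eq_zero).2 hv', hv1⟩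
  have h : iteratedDeriv (2 * l + 1) (fun _ : ℝ => (1 : ℝ)) = fun _ => 0 := by
    ext x
    exact iteratedDeriv_const.trans (by simp)
  rw [h]
  exact ⟨tendsto_const_nhds, tendsto_const_nhds⟩

/-! ### The error estimate on `(0, 1)`. -/

/-- The error estimate for the orthogonal projector onto `splineTilde`. -/
lemma norm_sub_projector_le {n q : ℕ} (hn : 0 < n) {P : H1 0 1 →ₗ[ℝ] H1 0 1}
    (hP : IsCircProjector (splineTilde (q + 1) n) P) (u : H1 0 1) :
    ‖((u - P u : H1 0 1) : L2 0 1)‖ ≤ 1 / n * ‖weakDeriv u‖ := by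
  set e := u - P u with he
  have hmean : integralHom 0 1 e = 0 := by
    obtain ⟨v, hv, hv', hv1⟩ := exists_one_splineTilde (q + 1) n
    have := hP.orth u v hv
    rw [circInner_eq, show weakDerivHom 0 1 v = 0 from hv', inner_zero_right,
      show integralHom 0 1 v = 1 from (integral_congr_ae hv1).trans (by simp), ← he] at this
    simpa only [sub_zero, div_one, zero_add, one_mul, mul_one] using this
  have horth : ∀ v ∈ splineTilde (q + 1) n, inner ℝ (weakDeriv e) (weakDeriv v) = (0 : ℝ) := by
    intro v hv
    have := hP.orth u v hv
    rw [circInner_eq, ← he, hmean, mul_zero, zero_mul, add_zero] at this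
    exact this
  have hle : ‖weakDeriv e‖ ≤ ‖weakDeriv u‖ := by
    -- The derivative of the error is orthogonal to that of `P u`, so it is an orthogonal component
    -- of the derivative of `u`.
    have h1 : inner ℝ (weakDeriv e) (weakDeriv e) = inner ℝ (weakDeriv e) (weakDeriv u) := by
      conv_lhs => rw [he]; rhs; rw [weakDeriv_sub]
      rw [inner_sub_right, ← he, horth _ (hP.mem u), sub_zero]
    have h2 := real_inner_le_norm (weakDeriv e) (weakDeriv u)
    rw [← h1, real_inner_self_eq_norm_sq, sq] at h2
    rcases (norm_nonneg (weakDeriv e)).eq_or_lt with h0 | h0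
    · rw [← h0]; exact norm_nonneg _
    · exact le_of_mul_le_mul_left h2 h0
  have hD := Lp.memLp (weakDeriv e)
  have hfam : ∀ d ∈ splineFamily n false q, ∫ x in (0 : ℝ)..1, weakDeriv e x * d x = 0 := by
    intro d hd
    obtain ⟨v, hv, hv'⟩ := exists_splineTilde_weakDeriv hd
    refine Eq.trans ?_ (horth v hv)
    rw [L2.inner_eq, ← setIntegral_Ioo zero_le_one]
    refine integral_congr_ae ?_
    filter_upwards [hv'] with x hx
    rw [hx]
  have hmain := integral_prim_sq_le hn q false hD hfam
  rw [Bool.not_false, ← setIntegral_Ioo zero_le_one, ← setIntegral_Ioo zero_le_one,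
    ← L2.norm_sq_eq] at hmain
  obtain ⟨c, hc⟩ := H1.exists_ae_eq one_pos e
  -- The mean of `e` is zero, which identifies `e` with `prim true` of its derivative.
  have hc0 : c = -∫ y in (0 : ℝ)..1, ∫ t in 0..y, weakDeriv e t := by
    have h1 : integralHom 0 1 e
        = ∫ x in Ioo (0 : ℝ) 1, (c + ∫ t in 0..x, weakDeriv e t) := integral_congr_ae hc
    rw [hmean, setIntegral_Ioo zero_le_one, intervalIntegral.integral_add intervalIntegrable_const
      (continuousOn_primitive (MemLp.intervalIntegrable hD)).intervalIntegrable,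
      intervalIntegral.integral_const] at h1
    simp only [sub_zero, one_smul] at h1
    linarith
  have heq : ∫ x in Ioo (0 : ℝ) 1, prim true (weakDeriv e) x ^ 2 = ‖(e : L2 0 1)‖ ^ 2 := by
    rw [L2.norm_sq_eq]
    refine integral_congr_ae ?_
    filter_upwards [hc] with x hx
    rw [hx, hc0]
    simp only [prim]
    ring
  rw [heq, ← mul_pow] at hmain
  exact (le_of_sq_le_sq hmain (by positivity)).trans
    (mul_le_mul_of_nonneg_left hle (by positivity))

/-! ### Even extension and folding. -/

lemma ae_neg {P : ℝ → Prop} (h : ∀ᵐ x : ℝ, P x) : ∀ᵐ x : ℝ, P (-x) :=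
  (Measure.measurePreserving_neg (volume : Measure ℝ)).quasiMeasurePreserving.ae h

lemma ae_symm_Ioo {P : ℝ → Prop} (h1 : ∀ᵐ x ∂volume.restrict (Ioo (0 : ℝ) 1), P x)
    (h2 : ∀ᵐ x ∂volume.restrict (Ioo (0 : ℝ) 1), P (-x)) :
    ∀ᵐ x ∂volume.restrict (Ioo (-1 : ℝ) 1), P x := by
  rw [ae_restrict_iff' measurableSet_Ioo] at *
  have h0 : ∀ᵐ x : ℝ, x ≠ 0 := Measure.ae_ne volume 0
  filter_upwards [h1, ae_neg h2, h0] with x h1 h2 h0 hx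
  rcases lt_or_gt_of_ne h0 with h | h
  · simpa using h2 ⟨by linarith, by linarith [hx.1]⟩
  · exact h1 ⟨h, hx.2⟩

lemma ae_pos_of_ae_symm {P : ℝ → Prop} (h : ∀ᵐ x ∂volume.restrict (Ioo (-1 : ℝ) 1), P x) :
    ∀ᵐ x ∂volume.restrict (Ioo (0 : ℝ) 1), P x :=
  ae_restrict_of_ae_restrict_of_subset (Ioo_subset_Ioo_left (by norm_num)) h

lemma ae_neg_of_ae_symm {P : ℝ → Prop} (h : ∀ᵐ x ∂volume.restrict (Ioo (-1 : ℝ) 1), P x) :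
    ∀ᵐ x ∂volume.restrict (Ioo (0 : ℝ) 1), P (-x) := by
  rw [ae_restrict_iff' measurableSet_Ioo] at *
  filter_upwards [ae_neg h] with x hx hx'
  exact hx ⟨by linarith [hx'.2], by linarith [hx'.1]⟩

lemma setIntegral_symm_Ioo {f : ℝ → ℝ} (hf : IntegrableOn f (Ioo (-1) 1)) :
    ∫ x in Ioo (-1 : ℝ) 1, f x = ∫ x in Ioo (0 : ℝ) 1, (f x + f (-x)) := by
  have hi : IntervalIntegrable f volume (-1) 1 := intervalIntegrable_of_Ioo (by norm_num) hf
  have h1 : IntervalIntegrable f volume (-1) 0 := hi.mono_set (by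
    rw [uIcc_of_le (by norm_num), uIcc_of_le (by norm_num)]
    exact Icc_subset_Icc_right (by norm_num))
  have h2 : IntervalIntegrable f volume 0 1 := hi.mono_set (by
    rw [uIcc_of_le (by norm_num), uIcc_of_le (by norm_num)]
    exact Icc_subset_Icc_left (by norm_num))
  have h3 : IntervalIntegrable (fun x => f (-x)) volume 0 1 := by
    simpa using h1.comp_sub_left 0 |>.symm
  rw [setIntegral_Ioo (by norm_num), setIntegral_Ioo zero_le_one,
    intervalIntegral.integral_add h2 h3, intervalIntegral.integral_comp_neg,
    ← intervalIntegral.integral_add_adjacent_intervals h1 h2, neg_zero, add_comm]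

lemma integral_zero_neg (f : ℝ → ℝ) (x : ℝ) :
    ∫ t in 0..-x, f t = -∫ t in 0..x, f (-t) := by
  rw [intervalIntegral.integral_comp_neg, neg_zero, intervalIntegral.integral_symm]

/-- Extension by zero from an open interval. -/
lemma memLp_indicator_L2 {a b : ℝ} (g : L2 a b) : MemLp ((Ioo a b).indicator g) 2 volume :=
  (memLp_indicator_iff_restrict measurableSet_Ioo).2 (Lp.memLp g)

/-- This antisymmetrisation serves twice: for `g` on `(0, 1)` it is the derivative of an even
extension, for `g` on `(-1, 1)` the derivative of a folded function. -/
lemma memLp_oddPart {a b : ℝ} (g : L2 a b) :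
    MemLp (fun x => (Ioo a b).indicator g x - (Ioo a b).indicator g (-x)) 2 volume :=
  (memLp_indicator_L2 g).sub
    ((memLp_indicator_L2 g).comp_measurePreserving (Measure.measurePreserving_neg _))

lemma MemLp.intervalIntegrable_volume {f : ℝ → ℝ} (hf : MemLp f 2 volume) (x y : ℝ) :
    IntervalIntegrable f volume x y := by
  exact ((hf.locallyIntegrable (by norm_num)).integrableOn_isCompact
    isCompact_uIcc).intervalIntegrable

/-- `w` is the even extension of `u`. -/
def IsEvenExt (w : H1 (-1) 1) (u : H1 0 1) : Prop :=
  ∀ᵐ x ∂volume.restrict (Ioo (-1 : ℝ) 1), (w : L2 (-1) 1) x = (u : L2 0 1) |x|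

lemma IsEvenExt.unique {w w' : H1 (-1) 1} {u : H1 0 1} (h : IsEvenExt w u)
    (h' : IsEvenExt w' u) : w = w' := by
  refine Subtype.ext (Lp.ext ?_)
  filter_upwards [h, h'] with x h1 h2
  rw [h1, h2]

lemma ae_abs {P : ℝ → Prop} (h : ∀ᵐ x ∂volume.restrict (Ioo (0 : ℝ) 1), P x) :
    ∀ᵐ x ∂volume.restrict (Ioo (-1 : ℝ) 1), P |x| := by
  have h' := (ae_restrict_mem measurableSet_Ioo).and h
  refine ae_symm_Ioo ?_ ?_
  · filter_upwards [h'] with x hx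
    rw [abs_of_pos hx.1.1]; exact hx.2
  · filter_upwards [h'] with x hx
    rw [abs_neg, abs_of_pos hx.1.1]; exact hx.2

lemma IsEvenExt.sub {w w' : H1 (-1) 1} {u u' : H1 0 1} (h : IsEvenExt w u)
    (h' : IsEvenExt w' u') : IsEvenExt (w - w') (u - u') := by
  filter_upwards [h, h', ae_abs (Lp.coeFn_sub (u : L2 0 1) (u' : L2 0 1)),
    Lp.coeFn_sub (w : L2 (-1) 1) (w' : L2 (-1) 1)] with x h1 h2 h3 h4
  refine (h4.trans ?_).trans h3.symm
  rw [Pi.sub_apply, Pi.sub_apply, h1, h2]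

/-- The even extension of a function in `H¹` is in `H¹`, and its weak derivative is odd. -/
lemma exists_isEvenExt (u : H1 0 1) : ∃ w : H1 (-1) 1, IsEvenExt w u ∧
    ∀ᵐ x ∂volume.restrict (Ioo (0 : ℝ) 1), weakDeriv w x = weakDeriv u x ∧
      weakDeriv w (-x) = -weakDeriv u x := by
  set k : ℝ → ℝ := (Ioo (0 : ℝ) 1).indicator (weakDeriv u) with hk
  let G : ℝ → ℝ := fun x => k x - k (-x)
  have hG : MemLp G 2 volume := memLp_oddPart (weakDeriv u)
  have hGi := MemLp.intervalIntegrable_volume hG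
  have hGneg : ∀ x, G (-x) = -G x := fun x => by simp only [G, neg_neg]; ring
  have hGpos : ∀ x ∈ Ioo (0 : ℝ) 1, G x = weakDeriv u x := fun x hx => by
    have h1 : -x ∉ Ioo (0 : ℝ) 1 := fun h => by linarith [h.1, hx.1]
    simp only [G, hk, indicator_of_mem hx, indicator_of_notMem h1, sub_zero]
  obtain ⟨c, hc⟩ := H1.exists_ae_eq one_pos u
  -- The constant is chosen so that `w` takes at 0 the boundary value `c` of `u`.
  obtain ⟨w, hw, hw'⟩ := exists_H1_of_primitive (a := -1) (b := 1) (by norm_num)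
    (hG.restrict _) (c - ∫ t in (-1 : ℝ)..0, G t)
  have hpos : ∀ x ∈ Ioo (0 : ℝ) 1, ∫ t in 0..x, G t = ∫ t in 0..x, weakDeriv u t := by
    intro x hx
    rw [← setIntegral_Ioo hx.1.le, ← setIntegral_Ioo hx.1.le]
    exact setIntegral_congr_fun measurableSet_Ioo fun t ht => hGpos t ⟨ht.1, ht.2.trans hx.2⟩
  have hw0 : ∀ᵐ x ∂volume.restrict (Ioo (-1 : ℝ) 1),
      (w : L2 (-1) 1) x = c + ∫ t in 0..x, G t := by
    filter_upwards [hw] with x hx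
    rw [hx, ← intervalIntegral.integral_add_adjacent_intervals (hGi (-1) 0) (hGi 0 x)]
    ring
  refine ⟨w, ae_symm_Ioo ?_ ?_, ?_⟩
  · filter_upwards [hc, ae_pos_of_ae_symm hw0, ae_restrict_mem measurableSet_Ioo] with x h1 h2 hx
    rw [h2, abs_of_pos hx.1, h1, hpos x hx]
  · filter_upwards [hc, ae_neg_of_ae_symm hw0, ae_restrict_mem measurableSet_Ioo] with x h1 h2 hx
    rw [h2, abs_neg, abs_of_pos hx.1, h1, integral_zero_neg]
    simp only [hGneg]
    rw [intervalIntegral.integral_neg, neg_neg, hpos x hx]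
  · filter_upwards [ae_pos_of_ae_symm hw', ae_neg_of_ae_symm hw',
      ae_restrict_mem measurableSet_Ioo] with x h1 h2 hx
    rw [h1, h2, hGneg, hGpos x hx]
    exact ⟨rfl, rfl⟩

/-- Twice the restriction to `(0, 1)` of the even part of a function in `H¹(-1, 1)`. -/
lemma exists_fold (v : H1 (-1) 1) : ∃ z : H1 0 1,
    (∀ᵐ x ∂volume.restrict (Ioo (0 : ℝ) 1),
      (z : L2 0 1) x = (v : L2 (-1) 1) x + (v : L2 (-1) 1) (-x)) ∧
    ∀ᵐ x ∂volume.restrict (Ioo (0 : ℝ) 1),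
      weakDeriv z x = weakDeriv v x - weakDeriv v (-x) := by
  set k : ℝ → ℝ := (Ioo (-1 : ℝ) 1).indicator (weakDeriv v) with hk
  have hki := MemLp.intervalIntegrable_volume (memLp_indicator_L2 (weakDeriv v))
  have hki' : ∀ x, IntervalIntegrable (fun t => k (-t)) volume 0 x := fun x => by
    simpa using ((hki (-0) (-x)).comp_sub_left 0)
  have hkv : ∀ x ∈ Ioo (-1 : ℝ) 1, k x = weakDeriv v x := fun x hx => by
    simp only [hk, indicator_of_mem hx]
  obtain ⟨c, hc⟩ := H1.exists_ae_eq (by norm_num) v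
  have hc0 : ∀ᵐ x ∂volume.restrict (Ioo (-1 : ℝ) 1),
      (v : L2 (-1) 1) x = (c + ∫ t in (-1 : ℝ)..0, k t) + ∫ t in 0..x, k t := by
    filter_upwards [hc, ae_restrict_mem measurableSet_Ioo] with x h1 hx
    rw [h1, add_assoc, intervalIntegral.integral_add_adjacent_intervals (hki (-1) 0) (hki 0 x),
      ← setIntegral_Ioo hx.1.le, ← setIntegral_Ioo hx.1.le]
    congr 1
    exact setIntegral_congr_fun measurableSet_Ioo fun t ht => (hkv t ⟨ht.1, ht.2.trans hx.2⟩).symm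
  obtain ⟨z, hz, hz'⟩ := exists_H1_of_primitive (a := 0) (b := 1) (by norm_num)
    ((memLp_oddPart (weakDeriv v)).restrict _) (2 * (c + ∫ t in (-1 : ℝ)..0, k t))
  refine ⟨z, ?_, ?_⟩
  · filter_upwards [hz, ae_pos_of_ae_symm hc0, ae_neg_of_ae_symm hc0] with x h1 h2 h3
    rw [h1, h2, h3, integral_zero_neg, intervalIntegral.integral_sub (hki 0 x) (hki' x)]
    ring
  · filter_upwards [hz', ae_restrict_mem measurableSet_Ioo] with x h1 hx
    rw [h1, ← hkv x ⟨by linarith [hx.1], hx.2⟩,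
      ← hkv (-x) ⟨by linarith [hx.2], by linarith [hx.1]⟩]

/-- The scalar product of an even function with an arbitrary one on `(-1, 1)`, as a scalar
product on `(0, 1)`. -/
lemma IsEvenExt.circInner_eq {w v : H1 (-1) 1} {u z : H1 0 1} (hw : IsEvenExt w u)
    (hz : ∀ᵐ x ∂volume.restrict (Ioo (0 : ℝ) 1),
      (z : L2 0 1) x = (v : L2 (-1) 1) x + (v : L2 (-1) 1) (-x))
    (hz' : ∀ᵐ x ∂volume.restrict (Ioo (0 : ℝ) 1),
      weakDeriv z x = weakDeriv v x - weakDeriv v (-x)) :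
    circInner w v = circInner u z := by
  obtain ⟨w', h1, h2⟩ := exists_isEvenExt u
  obtain rfl := hw.unique h1
  have e1 : ∫ x in Ioo (-1 : ℝ) 1, weakDeriv w x * weakDeriv v x
      = ∫ x in Ioo (0 : ℝ) 1, weakDeriv u x * weakDeriv z x := by
    have hi : IntegrableOn (fun x => weakDeriv w x * weakDeriv v x) (Ioo (-1) 1) :=
      (Lp.memLp (weakDeriv w)).integrable_mul (Lp.memLp (weakDeriv v))
    rw [setIntegral_symm_Ioo hi]
    refine integral_congr_ae ?_
    filter_upwards [h2, hz'] with x h3 h4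
    rw [h3.1, h3.2, h4]
    ring
  have e2 : ∫ x in Ioo (-1 : ℝ) 1, (w : L2 (-1) 1) x = 2 * ∫ x in Ioo (0 : ℝ) 1, (u : L2 0 1) x := by
    rw [setIntegral_symm_Ioo (L2.integrableOn _), ← integral_const_mul]
    refine integral_congr_ae ?_
    filter_upwards [ae_pos_of_ae_symm hw, ae_neg_of_ae_symm hw,
      ae_restrict_mem measurableSet_Ioo] with x h3 h4 hx
    rw [h3, h4, abs_neg, abs_of_pos hx.1]
    ring
  have e3 : ∫ x in Ioo (-1 : ℝ) 1, (v : L2 (-1) 1) x = ∫ x in Ioo (0 : ℝ) 1, (z : L2 0 1) x := by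
    rw [setIntegral_symm_Ioo (L2.integrableOn _)]
    refine integral_congr_ae ?_
    filter_upwards [hz] with x h3
    rw [h3]
  -- The doubled integral of `w` compensates the weight 1/2 that comes from the length of `(-1, 1)`.
  rw [circInner, circInner, e1, e2, e3]
  ring

/-! ### Splines under reflection. -/

lemma mem_cell_shift {n i : ℕ} (hn : 0 < n) {x : ℝ} :
    x ∈ cell (-1) 1 (2 * n) (n + i) ↔ x ∈ cell 0 1 n i := by
  have hn' : (n : ℝ) ≠ 0 := by exact_mod_cast hn.ne'
  have e1 : (-1 : ℝ) + ((n + i : ℕ) : ℝ) * ((1 - -1) / ((2 * n : ℕ) : ℝ)) = i * (1 / n) := by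
    push_cast; field_simp; ring
  have e2 : (-1 : ℝ) + (((n + i : ℕ) : ℝ) + 1) * ((1 - -1) / ((2 * n : ℕ) : ℝ))
      = (i + 1) * (1 / n) := by
    push_cast; field_simp; ring
  rw [cell_zero_one, cell, e1, e2]

lemma neg_mem_cell {n i : ℕ} (hi : i < n) {x : ℝ} :
    -x ∈ cell (-1) 1 (2 * n) (n - 1 - i) ↔ x ∈ cell 0 1 n i := by
  obtain ⟨j, rfl⟩ : ∃ j, n = j + 1 + i := ⟨n - 1 - i, by omega⟩
  rw [show j + 1 + i - 1 - i = j by omega]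
  have hn' : ((j + 1 + i : ℕ) : ℝ) ≠ 0 := by positivity
  have e1 : (-1 : ℝ) + (j : ℝ) * ((1 - -1) / ((2 * (j + 1 + i) : ℕ) : ℝ))
      = -((i + 1) * (1 / (j + 1 + i : ℕ))) := by
    push_cast at hn' ⊢; field_simp; ring
  have e2 : (-1 : ℝ) + ((j : ℝ) + 1) * ((1 - -1) / ((2 * (j + 1 + i) : ℕ) : ℝ))
      = -(i * (1 / (j + 1 + i : ℕ))) := by
    push_cast at hn' ⊢; field_simp; ring
  rw [cell_zero_one, cell, e1, e2, mem_Ioo, mem_Ioo, neg_lt_neg_iff, neg_lt_neg_iff, and_comm]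

lemma iteratedDeriv_eval (q : ℝ[X]) (l : ℕ) :
    iteratedDeriv l (fun x => q.eval x) = fun x => (Polynomial.derivative^[l] q).eval x := by
  induction l generalizing q with
  | zero => simp
  | succ l ih =>
    rw [iteratedDeriv_succ', show deriv (fun x => q.eval x) = fun x => q.derivative.eval x from
      funext fun x => q.deriv, ih, Function.iterate_succ_apply]

lemma iteratedDeriv_eq_of_eq_eval {c d : ℝ} {f : ℝ → ℝ} {q : ℝ[X]}
    (h : ∀ x ∈ Ioo c d, f x = q.eval x) (l : ℕ) {x : ℝ} (hx : x ∈ Ioo c d) :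
    iteratedDeriv l f x = (Polynomial.derivative^[l] q).eval x := by
  rw [← congrFun (iteratedDeriv_eval q l) x]
  refine Filter.EventuallyEq.iteratedDeriv_eq l ?_
  filter_upwards [isOpen_Ioo.mem_nhds hx] with y hy using h y hy

/-- Boundary values of derivatives can be read off from the polynomial on the adjacent cell. -/
lemma tendsto_iteratedDeriv_left {c d : ℝ} (hcd : c < d) {f : ℝ → ℝ} {q : ℝ[X]}
    (h : ∀ x ∈ Ioo c d, f x = q.eval x) (l : ℕ) :
    Tendsto (iteratedDeriv l f) (𝓝[>] c) (𝓝 ((Polynomial.derivative^[l] q).eval c)) := by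
  refine (((Polynomial.derivative^[l] q).continuous.tendsto c).mono_left
    nhdsWithin_le_nhds).congr' ?_
  filter_upwards [Ioo_mem_nhdsGT hcd] with x hx using (iteratedDeriv_eq_of_eq_eval h l hx).symm

lemma tendsto_iteratedDeriv_right {c d : ℝ} (hcd : c < d) {f : ℝ → ℝ} {q : ℝ[X]}
    (h : ∀ x ∈ Ioo c d, f x = q.eval x) (l : ℕ) :
    Tendsto (iteratedDeriv l f) (𝓝[<] d) (𝓝 ((Polynomial.derivative^[l] q).eval d)) := by
  refine (((Polynomial.derivative^[l] q).continuous.tendsto d).mono_left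
    nhdsWithin_le_nhds).congr' ?_
  filter_upwards [Ioo_mem_nhdsLT hcd] with x hx using (iteratedDeriv_eq_of_eq_eval h l hx).symm

lemma natDegree_comp_neg_le {q : ℝ[X]} {p : ℕ} (hq : q.natDegree ≤ p) :
    (q.comp (-Polynomial.X)).natDegree ≤ p := by
  refine Polynomial.natDegree_comp_le.trans ?_
  rw [Polynomial.natDegree_neg, Polynomial.natDegree_X, mul_one]
  exact hq

lemma IsSpline.continuousAt_iteratedDeriv {p N : ℕ} {a b : ℝ} {f : ℝ → ℝ}
    (hf : IsSpline p N a b f) {k : ℕ} (hk : k < p) {x : ℝ} (hx : x ∈ Ioo a b) :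
    ContinuousAt (iteratedDeriv k f) x := by
  have h1 : ContinuousOn (iteratedDerivWithin k f (Ioo a b)) (Ioo a b) :=
    hf.contDiffOn.continuousOn_iteratedDerivWithin
      (by exact_mod_cast Nat.le_sub_one_of_lt hk) isOpen_Ioo.uniqueDiffOn
  exact (h1.congr fun y hy => (iteratedDerivWithin_of_isOpen isOpen_Ioo hy).symm).continuousAt
    (isOpen_Ioo.mem_nhds hx)

/-- The reflected sum of a periodic spline. -/
lemma IsSpline.fold {p n : ℕ} (hn : 0 < n) {f : ℝ → ℝ} (hf : IsSpline p (2 * n) (-1) 1 f) :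
    IsSpline p n 0 1 (fun x => f x + f (-x)) := by
  refine ⟨?_, fun i hi => ?_⟩
  · have h1 : ContDiffOn ℝ ((p - 1 : ℕ) : ℕ∞) f (Ioo 0 1) :=
      hf.contDiffOn.mono (Ioo_subset_Ioo_left (by norm_num))
    refine h1.add (hf.contDiffOn.comp contDiff_neg.contDiffOn fun x hx => ?_)
    exact ⟨by linarith [hx.2], by linarith [hx.1]⟩
  · obtain ⟨q, hq, hq'⟩ := hf.piecewise (n + i) (by omega)
    obtain ⟨r, hr, hr'⟩ := hf.piecewise (n - 1 - i) (by omega)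
    refine ⟨q + r.comp (-Polynomial.X), Polynomial.natDegree_add_le_of_degree_le hq
      (natDegree_comp_neg_le hr), fun x hx => ?_⟩
    rw [hq' x ((mem_cell_shift hn).2 hx), hr' (-x) ((neg_mem_cell hi).2 hx)]
    simp

lemma tendsto_neg_nhdsLT_one : Tendsto (fun x : ℝ => -x) (𝓝[<] 1) (𝓝[>] (-1)) := tendsto_neg_nhdsLT

lemma tendsto_neg_nhdsGT_neg_one : Tendsto (fun x : ℝ => -x) (𝓝[>] (-1)) (𝓝[<] 1) := by
  simpa using tendsto_neg_nhdsGT_neg (a := (1 : ℝ))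

/-- An odd derivative of the fold is the difference of the derivatives of `f` at `x` and `-x`. It
tends to zero at 0 by continuity of the derivative there, and at 1 by periodicity. -/
lemma PeriodicDerivs.fold {p n : ℕ} {f : ℝ → ℝ} (hs : IsSpline p (2 * n) (-1) 1 f)
    (hf : PeriodicDerivs p (-1) 1 f) : OddDerivsVanish p 0 1 (fun x => f x + f (-x)) := by
  intro l hl
  have hk : ∀ x ∈ Ioo (-1 : ℝ) 1, iteratedDeriv (2 * l + 1) (fun x => f x + f (-x)) x
      = iteratedDeriv (2 * l + 1) f x - iteratedDeriv (2 * l + 1) f (-x) := by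
    intro x hx
    have hx' : -x ∈ Ioo (-1 : ℝ) 1 := ⟨by linarith [hx.2], by linarith [hx.1]⟩
    have h1 := hs.contDiffAt hl hx
    have h2 : ContDiffAt ℝ ((2 * l + 1 : ℕ)) (fun x => f (-x)) x :=
      (hs.contDiffAt hl hx').comp x contDiff_neg.contDiffAt
    have h3 := iteratedDeriv_add h1 h2
    have h4 := iteratedDeriv_comp_neg (2 * l + 1) f x
    rw [h4, pow_succ, pow_mul] at h3
    simp only [even_two, Even.neg_pow, one_pow, one_mul, neg_smul, one_smul] at h3
    exact h3
  constructor
  · have hc := hs.continuousAt_iteratedDeriv hl (x := 0) (by norm_num)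
    have hc' : Tendsto (fun x => iteratedDeriv (2 * l + 1) f (-x)) (𝓝 0)
        (𝓝 (iteratedDeriv (2 * l + 1) f 0)) := by
      refine Tendsto.comp hc ?_
      simpa using (continuous_neg.tendsto (0 : ℝ))
    have h1 := (Tendsto.sub hc hc').mono_left (nhdsWithin_le_nhds (s := Ioi 0))
    rw [sub_self] at h1
    refine h1.congr' ?_
    filter_upwards [Ioo_mem_nhdsGT (zero_lt_one' ℝ)] with x hx
    rw [hk x ⟨by linarith [hx.1], hx.2⟩]
  · obtain ⟨c, h1, h2⟩ := hf _ hl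
    have h3 := h2.sub (h1.comp tendsto_neg_nhdsLT_one)
    rw [sub_self] at h3
    refine h3.congr' ?_
    filter_upwards [Ioo_mem_nhdsLT (zero_lt_one' ℝ)] with x hx
    rw [hk x ⟨by linarith [hx.1], hx.2⟩, Function.comp_apply]

lemma mem_splineTilde_of_fold {p n : ℕ} (hn : 0 < n) {v : H1 (-1) 1} {z : H1 0 1}
    (hv : v ∈ splinePeriodic p n)
    (hz : ∀ᵐ x ∂volume.restrict (Ioo (0 : ℝ) 1),
      (z : L2 0 1) x = (v : L2 (-1) 1) x + (v : L2 (-1) 1) (-x)) :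
    z ∈ splineTilde p n := by
  obtain ⟨f, h1, h2, h3⟩ := hv
  refine ⟨_, h1.fold hn, h2.fold h1, ?_⟩
  filter_upwards [hz, ae_pos_of_ae_symm h3, ae_neg_of_ae_symm h3] with x h4 h5 h6
  rw [h4, h5, h6]

lemma contDiff_abs_mul_pow (m : ℕ) : ContDiff ℝ m (fun x : ℝ => |x| * x ^ m) := by
  induction m with
  | zero => exact contDiff_zero.2 (by fun_prop)
  | succ m ih =>
    have hd : ∀ x : ℝ, HasDerivAt (fun x : ℝ => |x| * x ^ (m + 1))
        ((m + 2) * (|x| * x ^ m)) x := by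
      -- At 0 the derivative exists because the formula valid elsewhere extends continuously.
      refine hasDerivAt_of_hasDerivAt_of_ne' (g := fun x => (m + 2) * (|x| * x ^ m)) (x := 0)
        (fun y hy => ?_) (by fun_prop) (by fun_prop)
      have h := (hasDerivAt_abs hy).mul (hasDerivAt_pow (m + 1) y)
      convert! h using 1
      have e : (SignType.sign y : ℝ) * y ^ (m + 1) = |y| * y ^ m := by
        rw [← sign_mul_self y]; ring
      rw [e, Nat.add_sub_cancel]
      push_cast
      ring
    push_cast
    rw [contDiff_succ_iff_deriv]
    refine ⟨fun x => (hd x).differentiableAt, by simp, ?_⟩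
    rw [funext fun x => (hd x).deriv]
    exact contDiff_const.mul ih

/-- A polynomial without odd powers of degree less than `p`, evaluated at `|x|`. -/
lemma contDiff_eval_abs {p : ℕ} {q : ℝ[X]} (hq : q.natDegree ≤ p)
    (h : ∀ l : ℕ, 2 * l + 1 < p → q.coeff (2 * l + 1) = 0) :
    ContDiff ℝ ((p - 1 : ℕ) : ℕ∞) (fun x => q.eval |x|) := by
  simp only [Polynomial.eval_eq_sum_range' (Nat.lt_succ_of_le hq)]
  refine ContDiff.sum fun k hk => ?_
  rcases Nat.even_or_odd k with hk' | ⟨l, rfl⟩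
  · simp only [hk'.pow_abs]
    fun_prop
  · rcases lt_or_ge (2 * l + 1) p with hlt | hge
    · simp only [h l hlt, zero_mul]
      exact contDiff_const
    -- Only the top power `|x|^p` with `p` odd can survive, and it has exactly the `p - 1`
    -- continuous derivatives needed.
    · obtain rfl : p = 2 * l + 1 := le_antisymm hge (by simpa [Nat.lt_succ_iff] using hk)
      have e : ∀ x : ℝ, |x| ^ (2 * l + 1) = |x| * x ^ (2 * l) := fun x => by
        rw [pow_succ, (even_two_mul l).pow_abs, mul_comm]
      simp only [e]
      exact contDiff_const.mul (contDiff_abs_mul_pow (2 * l))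

/-- Even extensions of splines in `splineTilde` are periodic splines. -/
lemma exists_periodic_of_oddDerivsVanish {p n : ℕ} (hn : 0 < n) {f : ℝ → ℝ}
    (hf : IsSpline p n 0 1 f) (hf' : OddDerivsVanish p 0 1 f) :
    ∃ F : ℝ → ℝ, IsSpline p (2 * n) (-1) 1 F ∧ PeriodicDerivs p (-1) 1 F ∧
      ∀ x ≠ 0, F x = f |x| := by
  have hn' : (0 : ℝ) < n := by exact_mod_cast hn
  obtain ⟨q, hq, hq'⟩ := hf.piecewise 0 hn
  obtain ⟨r, hr, hr'⟩ := hf.piecewise (n - 1) (by omega)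
  set δ : ℝ := 1 / n with hδ
  have hδ0 : 0 < δ := by positivity
  replace hq' : ∀ x ∈ Ioo 0 δ, f x = q.eval x := fun x hx => hq' x (by simpa [hδ] using hx)
  replace hr' : ∀ x ∈ Ioo (1 - δ) 1, f x = r.eval x := fun x hx => hr' x (by
    have e1 : ((n - 1 : ℕ) : ℝ) = n - 1 := by rw [Nat.cast_sub hn, Nat.cast_one]
    have e2 : ((n : ℝ) - 1) * (1 / n) = 1 - δ := by rw [hδ]; field_simp
    have e3 : ((n : ℝ) - 1 + 1) * (1 / n) = 1 := by field_simp; ring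
    rw [e1, zero_add, zero_add, sub_zero, e2, e3]
    exact hx)
  -- The spline conditions leave `f 0` arbitrary, so the value at 0 is taken from the polynomial on
  -- the first cell.
  let F : ℝ → ℝ := fun x => if x = 0 then q.eval 0 else f |x|
  have hF : ∀ x ≠ 0, F x = f |x| := fun x hx => if_neg hx
  have hFpos : ∀ x > 0, F x = f x := fun x hx => by rw [hF x hx.ne', abs_of_pos hx]
  have hFneg : ∀ x < 0, F x = f (-x) := fun x hx => by rw [hF x hx.ne, abs_of_neg hx]
  have hF0 : ∀ x ∈ Ioo (-δ) δ, F x = q.eval |x| := fun x hx => by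
    rcases eq_or_ne x 0 with rfl | h
    · simp [F]
    · rw [hF x h, hq' _ ⟨abs_pos.2 h, abs_lt.2 hx⟩]
  have hcoeff : ∀ l : ℕ, 2 * l + 1 < p → q.coeff (2 * l + 1) = 0 := by
    intro l hl
    -- The boundary value of the derivative of order `2 * l + 1` is a factorial times the
    -- coefficient.
    have h := tendsto_nhds_unique (tendsto_iteratedDeriv_left hδ0 hq' (2 * l + 1)) (hf' l hl).1
    rw [← Polynomial.coeff_zero_eq_eval_zero, Polynomial.coeff_iterate_derivative, zero_add,
      Nat.descFactorial_self, nsmul_eq_mul] at h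
    exact (mul_eq_zero.1 h).resolve_left (by exact_mod_cast Nat.factorial_ne_zero _)
  refine ⟨F, ⟨fun x hx => ?_, fun j hj => ?_⟩, fun l hl => ?_, hF⟩
  · refine ContDiffAt.contDiffWithinAt ?_
    rcases lt_trichotomy x 0 with h | rfl | h
    · have h1 : ContDiffAt ℝ ((p - 1 : ℕ) : ℕ∞) (fun x => f (-x)) x :=
        (hf.contDiffOn.contDiffAt (isOpen_Ioo.mem_nhds
          (⟨by linarith, by linarith [hx.1]⟩ : -x ∈ Ioo (0 : ℝ) 1))).comp x
          contDiff_neg.contDiffAt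
      refine h1.congr_of_eventuallyEq ?_
      filter_upwards [Iio_mem_nhds h] with y hy using hFneg y hy
    · refine (contDiff_eval_abs hq hcoeff).contDiffAt.congr_of_eventuallyEq ?_
      filter_upwards [Ioo_mem_nhds (neg_lt_zero.2 hδ0) hδ0] with y hy using hF0 y hy
    · refine (hf.contDiffOn.contDiffAt (isOpen_Ioo.mem_nhds ⟨h, hx.2⟩)).congr_of_eventuallyEq ?_
      filter_upwards [Ioi_mem_nhds h] with y hy using hFpos y hy
  · rcases lt_or_ge j n with hjn | hjn
    · obtain ⟨s, hs, hs'⟩ := hf.piecewise (n - 1 - j) (by omega)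
      refine ⟨s.comp (-Polynomial.X), natDegree_comp_neg_le hs, fun x hx => ?_⟩
      have hx' : -x ∈ cell 0 1 n (n - 1 - j) := by
        rw [← neg_mem_cell (by omega), neg_neg, show n - 1 - (n - 1 - j) = j by omega]
        exact hx
      have hx0 := (cell_subset (by omega) hx').1
      rw [hFneg x (by linarith), hs' _ hx']
      simp
    · obtain ⟨s, hs, hs'⟩ := hf.piecewise (j - n) (by omega)
      refine ⟨s, hs, fun x hx => ?_⟩
      have hx' : x ∈ cell 0 1 n (j - n) := by
        rw [← mem_cell_shift hn, Nat.add_sub_cancel' hjn]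
        exact hx
      rw [hFpos x (cell_subset (by omega) hx').1, hs' _ hx']
  · have hright := tendsto_iteratedDeriv_right (by linarith : 1 - δ < 1) hr' l
    set c := (Polynomial.derivative^[l] r).eval 1
    have h1 : Tendsto (iteratedDeriv l F) (𝓝[<] 1) (𝓝 c) := by
      refine hright.congr' ?_
      filter_upwards [Ioo_mem_nhdsLT (zero_lt_one' ℝ)] with x hx
      refine Filter.EventuallyEq.iteratedDeriv_eq l ?_
      filter_upwards [Ioi_mem_nhds hx.1] with y hy using (hFpos y hy).symm
    have h2 : Tendsto (iteratedDeriv l F) (𝓝[>] (-1)) (𝓝 ((-1) ^ l * c)) := by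
      refine ((hright.comp tendsto_neg_nhdsGT_neg_one).const_mul ((-1) ^ l)).congr' ?_
      filter_upwards [Ioo_mem_nhdsGT (by norm_num : (-1 : ℝ) < 0)] with x hx
      have h3 : F =ᶠ[𝓝 x] fun y => f (-y) := by
        filter_upwards [Iio_mem_nhds hx.2] with y hy using hFneg y hy
      rw [h3.iteratedDeriv_eq l, iteratedDeriv_comp_neg, Function.comp_apply, smul_eq_mul]
    refine ⟨c, ?_, h1⟩
    -- Even derivatives of `F` are even and so agree at the two ends; odd ones change sign and agree
    -- because they vanish at 1.
    rcases Nat.even_or_odd l with he | ⟨m, rfl⟩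
    · simpa [he.neg_one_pow] using h2
    · have hc : c = 0 := tendsto_nhds_unique hright (hf' m hl).2
      simpa [hc] using h2

lemma IsEvenExt.mem_splinePeriodic {p n : ℕ} (hn : 0 < n) {w : H1 (-1) 1} {u : H1 0 1}
    (hw : IsEvenExt w u) (hu : u ∈ splineTilde p n) : w ∈ splinePeriodic p n := by
  obtain ⟨f, h1, h2, h3⟩ := hu
  obtain ⟨F, h4, h5, h6⟩ := exists_periodic_of_oddDerivsVanish hn h1 h2
  refine ⟨F, h4, h5, ?_⟩
  filter_upwards [hw, ae_abs h3, ae_restrict_of_ae (Measure.ae_ne volume 0)] with x h7 h8 h9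
  rw [h7, h8, h6 x h9]

/-! ### Comparison of the two projectors. -/

/-- The projector on `(-1, 1)` maps even extensions to even extensions of projections. -/
lemma isEvenExt_projector {p n : ℕ} (hn : 0 < n) {P : H1 0 1 →ₗ[ℝ] H1 0 1}
    {Q : H1 (-1) 1 →ₗ[ℝ] H1 (-1) 1} (hP : IsCircProjector (splineTilde p n) P)
    (hQ : IsCircProjector (splinePeriodic p n) Q) {w : H1 (-1) 1} {u : H1 0 1}
    (hw : IsEvenExt w u) : IsEvenExt (Q w) (P u) := by
  obtain ⟨w', hw', -⟩ := exists_isEvenExt (P u)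
  have hm : Q w - w' ∈ splinePeriodic p n :=
    Submodule.sub_mem _ (hQ.mem w) (hw'.mem_splinePeriodic hn (hP.mem u))
  -- For `v = Q w - w'`, the product of `w - w'` with `v` becomes that of `u - P u` with the fold of
  -- `v`, which is zero. The product of `w - Q w` with `v` is zero too, and subtracting the two
  -- leaves the claim.
  have h0 : circInner (Q w - w') (Q w - w') = 0 := by
    obtain ⟨z, hz, hz'⟩ := exists_fold (Q w - w')
    have h1 := (hw.sub hw').circInner_eq hz hz'
    rw [hP.orth u z (mem_splineTilde_of_fold hn hm hz), circInner_sub_left] at h1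
    have h2 := hQ.orth w _ hm
    rw [circInner_sub_left] at h2
    rw [circInner_sub_left]
    linarith
  rwa [sub_eq_zero.1 (eq_zero_of_circInner_self (by norm_num) h0)]

end SplineApprox

theorem theoremA1 (n₀ ℓ p : ℕ) (hn₀ : 1 ≤ n₀) (hp : 1 ≤ p) :
    (∃! P : SplineApprox.H1 0 1 →ₗ[ℝ] SplineApprox.H1 0 1,
      SplineApprox.IsCircProjector
        (SplineApprox.splineTilde p (SplineApprox.cells n₀ ℓ)) P) ∧
    (∃! Q : SplineApprox.H1 (-1) 1 →ₗ[ℝ] SplineApprox.H1 (-1) 1,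
      SplineApprox.IsCircProjector
        (SplineApprox.splinePeriodic p (SplineApprox.cells n₀ ℓ)) Q) ∧
    ∀ (P : SplineApprox.H1 0 1 →ₗ[ℝ] SplineApprox.H1 0 1)
      (Q : SplineApprox.H1 (-1) 1 →ₗ[ℝ] SplineApprox.H1 (-1) 1),
      SplineApprox.IsCircProjector
        (SplineApprox.splineTilde p (SplineApprox.cells n₀ ℓ)) P →
      SplineApprox.IsCircProjector
        (SplineApprox.splinePeriodic p (SplineApprox.cells n₀ ℓ)) Q →
      (∀ u : SplineApprox.H1 0 1,
        ‖((u - P u : SplineApprox.H1 0 1) : SplineApprox.L2 0 1)‖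
          ≤ √2 * SplineApprox.gridSize n₀ ℓ * ‖SplineApprox.weakDeriv u‖) ∧
      (∀ u : SplineApprox.H1 0 1, ∃ w : SplineApprox.H1 (-1) 1,
        (∀ᵐ x ∂volume.restrict (Ioo (-1 : ℝ) 1),
          (w : SplineApprox.L2 (-1) 1) x = (u : SplineApprox.L2 0 1) |x|) ∧
        (∀ᵐ x ∂volume.restrict (Ioo (0 : ℝ) 1),
          (Q w : SplineApprox.L2 (-1) 1) x = (P u : SplineApprox.L2 0 1) x)) := by
  have hn : 0 < SplineApprox.cells n₀ ℓ := Nat.mul_pos hn₀ (by positivity)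
  have := SplineApprox.finiteDimensional_splineTilde (p := p) hn
  have := SplineApprox.finiteDimensional_splinePeriodic (p := p) hn
  refine ⟨SplineApprox.existsUnique_isCircProjector one_pos _,
    SplineApprox.existsUnique_isCircProjector (by norm_num) _, fun P Q hP hQ =>
    ⟨fun u => ?_, fun u => ?_⟩⟩
  · obtain ⟨q, rfl⟩ := Nat.exists_eq_add_of_le' hp
    refine (SplineApprox.norm_sub_projector_le hn hP u).trans ?_
    refine mul_le_mul_of_nonneg_right ?_ (norm_nonneg _)
    -- The bound already holds with constant 1, and 1 ≤ √2.
    refine le_mul_of_one_le_left (by positivity) ?_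
    exact Real.one_le_sqrt.2 (by norm_num)
  · obtain ⟨w, hw, -⟩ := SplineApprox.exists_isEvenExt u
    refine ⟨w, hw, ?_⟩
    filter_upwards [SplineApprox.ae_pos_of_ae_symm (SplineApprox.isEvenExt_projector hn hP hQ hw),
      ae_restrict_mem measurableSet_Ioo] with x h1 hx
    rw [h1, abs_of_pos hx.1]
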